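/- Let $N\ge 1$, $1<p<\infty$, $0<s<1$, and let $\Omega\subsetneq\mathbb{R}^N$ be an open convex set. Write $d_\Omega(x)=\min_{y\in\partial\Omega}|x-y|$ for $x\in\Omega$, $J_p(t)=|t|^{p-2}t$ (with $J_p(0)=0$), and, for $\beta\in\mathbb{R}$, let $U_\beta=d_\Omega^\beta$ in $\Omega$ and $U_\beta=0$ in $\mathbb{R}^N\setminus\Omega$ (so $U_0=1_\Omega$). Set $$\lambda(\beta)=2\int_0^1\frac{J_p(1-t^\beta)}{(1-t)^{1+sp}}\Big(1-t^{sp-1-\beta(p-1)}\Big)\,dt+\frac{2}{sp},$$ and $C_{1,sp}=1$, while for $N\ge 2$ $$C_{N,sp}=(N-1)\,\omega_{N-1}\int_0^{+\infty}t^{N-2}(1+t^2)^{-\frac{N+sp}{2}}\,dt,$$ where $\omega_{k}$ is the volume of the unit ball of $\mathbb{R}^{k}$. For $\lambda\in\mathbb{R}$, consider the equation $$(-\Delta_p)^su=\lambda\,\frac{|u|^{p-2}u}{d_\Omega^{sp}}\quad\text{in }\Omega.\qquad(\ast)$$ For an open set $E\subseteq\mathbb{R}^N$, $W^{s,p}(E)$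 is the space of all $u\in L^p(E)$ with $\iint_{E\times E}\frac{|u(x)-u(y)|^p}{|x-y|^{N+sp}}\,dx\,dy<\infty$. A function $u$ is a local weak supersolution of $(\ast)$ if * $u\in W^{s,p}(\Omega')$ for every open $\Omega'$ whose closure is a compact subset of $\Omega$; * $u\in L^{p-1}_{\rm loc}(\mathbb{R}^N)$ and $\int_{\mathbb{R}^N}\frac{|u(x)|^{p-1}}{(1+|x|)^{N+sp}}\,dx<\infty$; * for every non-negative $\varphi\in W^{s,p}(\mathbb{R}^N)$ with compact support in $\Omega$, the two integrals below converge absolutely and $$\iint_{\mathbb{R}^N\times\mathbb{R}^N}\frac{J_p(u(x)-u(y))\,(\varphi(x)-\varphi(y))}{|x-y|^{N+sp}}\,dx\,dy\;\ge\;\lambda\int_\Omega\frac{|u(x)|^{p-2}u(x)}{d_\Omega(x)^{sp}}\,\varphi(x)\,dx.$$ It is a local weak subsolution if the same holds with $\le$ in place of $\ge$, and a local weak solution if it is both. Then: 1. if $0\le\beta<\frac{sp}{p-1}$, then $U_\beta$ is a local weak supersolution of $(\ast)$ with $\lambda=C_{N,sp}\,\lambda(\beta)$; 2. if $\Omega$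 is an open half-space and $-\frac1{p-1}<\beta<\frac{sp}{p-1}$, then $U_\beta$ is a local weak solution of $(\ast)$ with $\lambda=C_{N,sp}\,\lambda(\beta)$. -/

import Mathlib

noncomputable section

namespace FracHardy

open MeasureTheory Set

/-- The space `ℝ^N` with its Euclidean norm and Lebesgue measure. -/
abbrev Eu (N : ℕ) : Type := EuclideanSpace ℝ (Fin N)

/-- `J_p(t) = |t|^{p-2} t`. -/
def Jp (p t : ℝ) : ℝ := |t| ^ (p - 2) * t

/-- The distance from the boundary `d_Ω(x)`. -/
def bdist {N : ℕ} (Ω : Set (Eu N)) (x : Eu N) : ℝ := Metric.infDist x (frontier Ω)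

/-- `U_β = d_Ω^β` in `Ω`, extended by `0` outside `Ω` (for `β = 0`, the characteristic
function of `Ω`). -/
def distPow {N : ℕ} (Ω : Set (Eu N)) (β : ℝ) : Eu N → ℝ :=
  Ω.indicator fun x => bdist Ω x ^ β

/-- The `p`-th power of the Gagliardo seminorm on `E`, as an extended nonnegative real. -/
def gagliardo {N : ℕ} (s p : ℝ) (E : Set (Eu N)) (u : Eu N → ℝ) : ENNReal :=
  ∫⁻ z in E ×ˢ E, ENNReal.ofReal (|u z.1 - u z.2| ^ p / ‖z.1 - z.2‖ ^ ((N : ℝ) + s * p))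

/-- `u ∈ W^{s,p}(E)`. -/
def MemW {N : ℕ} (s p : ℝ) (E : Set (Eu N)) (u : Eu N → ℝ) : Prop :=
  MemLp u (ENNReal.ofReal p) (volume.restrict E) ∧ gagliardo s p E u < ⊤

/-- `u ∈ W^{s,p}_loc(Ω)`: `u ∈ W^{s,p}(Ω')` for every open `Ω'` whose closure is a compact
subset of `Ω` (this contains `u ∈ L^p_loc(Ω)`). -/
def MemWloc {N : ℕ} (s p : ℝ) (Ω : Set (Eu N)) (u : Eu N → ℝ) : Prop :=
  ∀ Ω' : Set (Eu N), IsOpen Ω' → IsCompact (closure Ω') → closure Ω' ⊆ Ω → MemW s p Ω' u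

/-- The weighted space `L^q_α(ℝ^N)`: `u ∈ L^q_loc(ℝ^N)` and
`|u|^q (1 + |x|)^{-N-α}` is integrable. -/
def MemTail {N : ℕ} (q α : ℝ) (u : Eu N → ℝ) : Prop :=
  (∀ K : Set (Eu N), IsCompact K → MemLp u (ENNReal.ofReal q) (volume.restrict K)) ∧
    Integrable fun x : Eu N => |u x| ^ q / (1 + ‖x‖) ^ ((N : ℝ) + α)

/-- The integrand of the weak form of `(-Δ_p)^s u` tested against `φ`. -/
def energyIntegrand {N : ℕ} (s p : ℝ) (u φ : Eu N → ℝ) (z : Eu N × Eu N) : ℝ :=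
  Jp p (u z.1 - u z.2) * (φ z.1 - φ z.2) / ‖z.1 - z.2‖ ^ ((N : ℝ) + s * p)

/-- The integrand `|u|^{p-2} u φ / d_Ω^{sp}`. -/
def hardyIntegrand {N : ℕ} (s p : ℝ) (Ω : Set (Eu N)) (u φ : Eu N → ℝ) (x : Eu N) : ℝ :=
  Jp p (u x) / bdist Ω x ^ (s * p) * φ x

/-- Test functions: non-negative elements of `W^{s,p}(ℝ^N)` with compact support in `Ω`. -/
def IsTest {N : ℕ} (s p : ℝ) (Ω : Set (Eu N)) (φ : Eu N → ℝ) : Prop :=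
  MemW s p univ φ ∧ (∀ x, 0 ≤ φ x) ∧ HasCompactSupport φ ∧ tsupport φ ⊆ Ω

/-- Local weak supersolutions of `(-Δ_p)^s u = lam |u|^{p-2} u / d_Ω^{sp}` in `Ω`. Absolute
convergence of the two integrals is recorded explicitly. -/
def IsLocalWeakSupersolution {N : ℕ} (s p : ℝ) (Ω : Set (Eu N)) (lam : ℝ)
    (u : Eu N → ℝ) : Prop :=
  MemWloc s p Ω u ∧ MemTail (p - 1) (s * p) u ∧
    ∀ φ : Eu N → ℝ, IsTest s p Ω φ →
      Integrable (energyIntegrand s p u φ) ∧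
      IntegrableOn (hardyIntegrand s p Ω u φ) Ω ∧
      lam * ∫ x in Ω, hardyIntegrand s p Ω u φ x ≤ ∫ z, energyIntegrand s p u φ z

/-- Local weak subsolutions of the same equation. -/
def IsLocalWeakSubsolution {N : ℕ} (s p : ℝ) (Ω : Set (Eu N)) (lam : ℝ)
    (u : Eu N → ℝ) : Prop :=
  MemWloc s p Ω u ∧ MemTail (p - 1) (s * p) u ∧
    ∀ φ : Eu N → ℝ, IsTest s p Ω φ →
      Integrable (energyIntegrand s p u φ) ∧
      IntegrableOn (hardyIntegrand s p Ω u φ) Ω ∧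
      ∫ z, energyIntegrand s p u φ z ≤ lam * ∫ x in Ω, hardyIntegrand s p Ω u φ x

/-- Local weak solutions of the same equation. -/
def IsLocalWeakSolution {N : ℕ} (s p : ℝ) (Ω : Set (Eu N)) (lam : ℝ)
    (u : Eu N → ℝ) : Prop :=
  IsLocalWeakSupersolution s p Ω lam u ∧ IsLocalWeakSubsolution s p Ω lam u

/-- The constant `λ(β)`. -/
def lamConst (s p β : ℝ) : ℝ :=
  2 * (∫ t in Ioo (0 : ℝ) 1,
    Jp p (1 - t ^ β) / (1 - t) ^ (1 + s * p) * (1 - t ^ (s * p - 1 - β * (p - 1))))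
    + 2 / (s * p)

/-- `𝓘(k; α) = ∫_0^∞ t^k (1 + t²)^{-(k+2+α)/2} dt`. -/
def calI (k : ℕ) (α : ℝ) : ℝ :=
  ∫ t in Ioi (0 : ℝ), t ^ k * (1 + t ^ 2) ^ (-(((k : ℝ) + 2 + α) / 2))

/-- The volume `ω_k` of the unit ball of `ℝ^k`. -/
def omega (k : ℕ) : ℝ := volume.real (Metric.ball (0 : Eu k) 1)

/-- The constant `C_{N,α}`, for `N ≥ 1`. -/
def CN (N : ℕ) (α : ℝ) : ℝ :=
  if N = 1 then 1 else ((N : ℝ) - 1) * omega (N - 1) * calI (N - 2) α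

/-- Open half-spaces of `ℝ^N`. -/
def IsHalfSpace {N : ℕ} (Ω : Set (Eu N)) : Prop :=
  ∃ ν : Eu N, ν ≠ 0 ∧ ∃ c : ℝ, Ω = {x | c < inner ℝ ν x}

end FracHardy

end

noncomputable section

namespace FracHardy

open MeasureTheory Set Filter Topology

/-! Write α = sp and `u` for the distance power. The energy integrand is absolutely integrable, so
the energy is the limit of its restrictions to pairs with |x - y| > ε. There antisymmetry of J_p and
Fubini turn it into 2 ∫ φ(x) T_ε u(x) dx, where T_ε is the truncated operator `truncPV`
(`integral_far_energy`, `tendsto_truncated_energy`). No pointwise principal value of u is ever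
needed.

T_ε is then compared with its value on a half-space profile. At x in a convex Ω, a supporting
half-space at a nearest boundary point has the same distance to x and a larger or equal distance to
every other point of Ω. For β ≥ 0 its profile lies above u and touches it at x, so monotonicity of
J_p bounds T_ε u(x) below by T_ε of the profile. By scaling, the latter is d(x)^(β(p-1)-α)
`halfPV`(ε/d(x)). On a half-space the comparison is an equality, which yields solutions and allows
negative β.

It remains to see that `halfPV` is bounded and tends to `CN` * `lamConst` / 2. In the coordinates w
= (τ, |τ|z) it becomes an integral over z of one-dimensional principal values `linePV` with weight
(1+|z|²)^(-(N+α)/2), whose integral is `CN`. On the line, the substitution t ↦ 1/t folds (1,∞) onto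
(0,1) and produces the integrand of `lamConst`, while the half-line t ≤ 0 contributes 1/α
(`tendsto_linePV`). -/

/-! ### The function J_p and positive powers -/

lemma abs_Jp {p : ℝ} (hp : 1 < p) (t : ℝ) : |Jp p t| = |t| ^ (p - 1) := by
  rcases eq_or_ne t 0 with rfl | ht
  · simp [Jp, Real.zero_rpow (by linarith : p - 1 ≠ 0)]
  · have h : 0 < |t| := abs_pos.2 ht
    rw [Jp, abs_mul, abs_of_nonneg (Real.rpow_nonneg h.le _)]
    conv_lhs => rw [← Real.rpow_one |t|, ← Real.rpow_mul h.le, ← Real.rpow_add h]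
    congr 1; ring

lemma Jp_neg (p t : ℝ) : Jp p (-t) = -Jp p t := by simp [Jp]

lemma Jp_of_nonneg {p : ℝ} (hp : 1 < p) {t : ℝ} (ht : 0 ≤ t) : Jp p t = t ^ (p - 1) := by
  have h := abs_Jp hp t
  have hJ : 0 ≤ Jp p t := mul_nonneg (Real.rpow_nonneg (abs_nonneg _) _) ht
  rwa [abs_of_nonneg hJ, abs_of_nonneg ht] at h

lemma Jp_mono {p : ℝ} (hp : 1 < p) : Monotone (Jp p) := by
  have hnn : ∀ {a b : ℝ}, 0 ≤ a → a ≤ b → Jp p a ≤ Jp p b := fun {a b} ha hab => by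
    rw [Jp_of_nonneg hp ha, Jp_of_nonneg hp (ha.trans hab)]
    exact Real.rpow_le_rpow ha hab (by linarith)
  have hsign : ∀ {a : ℝ}, 0 ≤ a → 0 ≤ Jp p a := fun {a} ha => by
    rw [Jp_of_nonneg hp ha]; positivity
  intro a b hab
  rcases le_total 0 a with ha | ha
  · exact hnn ha hab
  rcases le_total 0 b with hb | hb
  · have := hsign (neg_nonneg.2 ha)
    rw [Jp_neg] at this
    linarith [hsign hb]
  · have := hnn (neg_nonneg.2 hb) (neg_le_neg hab)
    rw [Jp_neg, Jp_neg] at this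
    linarith

lemma Jp_mul (p : ℝ) {c : ℝ} (hc : 0 < c) (t : ℝ) :
    Jp p (c * t) = c ^ (p - 1) * Jp p t := by
  rw [Jp, Jp, abs_mul, abs_of_pos hc, Real.mul_rpow hc.le (abs_nonneg _),
    show p - 1 = (p - 2) + 1 by ring, Real.rpow_add hc, Real.rpow_one]
  ring

@[fun_prop]
lemma measurable_Jp (p : ℝ) : Measurable (Jp p) := by
  unfold Jp; fun_prop

/-- Comparison with the maximum works for every q > 0; convexity would not be available for q = p -
1 < 1. -/
lemma abs_sub_rpow_le {q : ℝ} (hq : 0 < q) (a b : ℝ) :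
    |a - b| ^ q ≤ 2 ^ q * (|a| ^ q + |b| ^ q) := by
  have h : |a - b| ≤ 2 * max |a| |b| := by
    have := abs_sub a b
    linarith [le_max_left |a| |b|, le_max_right |a| |b|]
  calc |a - b| ^ q ≤ (2 * max |a| |b|) ^ q := Real.rpow_le_rpow (abs_nonneg _) h hq.le
    _ = 2 ^ q * (max |a| |b|) ^ q := Real.mul_rpow (by norm_num) (by positivity)
    _ ≤ 2 ^ q * (|a| ^ q + |b| ^ q) := by
      gcongr
      have ha : 0 ≤ |a| ^ q := by positivity
      have hb : 0 ≤ |b| ^ q := by positivity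
      rcases max_cases |a| |b| with h | h <;> rw [h.1] <;> linarith

lemma abs_Jp_sub_le {p : ℝ} (hp : 1 < p) (a b : ℝ) :
    |Jp p (a - b)| ≤ 2 ^ (p - 1) * (|a| ^ (p - 1) + |b| ^ (p - 1)) := by
  rw [abs_Jp hp]
  exact abs_sub_rpow_le (by linarith) a b

/-- The positive power `t_+^β`, with value `1` on `t > 0` for `β = 0`. -/
def posPow (β t : ℝ) : ℝ := (Ioi 0).indicator (fun t => t ^ β) t

lemma posPow_of_pos {β t : ℝ} (ht : 0 < t) : posPow β t = t ^ β := by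
  simp [posPow, ht]

lemma posPow_of_nonpos {β t : ℝ} (ht : t ≤ 0) : posPow β t = 0 := by
  simp [posPow, ht]

lemma posPow_nonneg (β t : ℝ) : 0 ≤ posPow β t := by
  rcases le_or_gt t 0 with h | h
  · rw [posPow_of_nonpos h]
  · rw [posPow_of_pos h]; positivity

lemma posPow_mul {β d : ℝ} (hd : 0 < d) (t : ℝ) : posPow β (d * t) = d ^ β * posPow β t := by
  rcases le_or_gt t 0 with h | h
  · rw [posPow_of_nonpos h, posPow_of_nonpos (mul_nonpos_of_nonneg_of_nonpos hd.le h), mul_zero]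
  · rw [posPow_of_pos h, posPow_of_pos (mul_pos hd h), Real.mul_rpow hd.le h.le]

@[fun_prop]
lemma measurable_posPow (β : ℝ) : Measurable (posPow β) := by
  unfold posPow
  exact Measurable.indicator (by fun_prop) measurableSet_Ioi

/-! ### Slicing and the constant C_{N,α} -/

/-- Orthogonal slicing of Euclidean space along a unit vector. -/
lemma exists_slicing {n : ℕ} {ν : Eu (n + 1)} (hν : ‖ν‖ = 1) :
    ∃ Φ : Eu (n + 1) ≃ᵐ ℝ × Eu n, MeasurePreserving Φ volume volume ∧
      (∀ w, (Φ w).1 = inner ℝ ν w) ∧ ∀ w, ‖w‖ ^ 2 = (Φ w).1 ^ 2 + ‖(Φ w).2‖ ^ 2 := by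
  obtain ⟨b, hb⟩ := Orthonormal.exists_orthonormalBasis_extension_of_card_eq (𝕜 := ℝ)
    (E := Eu (n + 1)) (ι := Fin (n + 1)) (by simp) (v := fun _ => ν) (s := {0})
    (by
      rw [orthonormal_iff_ite]
      rintro ⟨i, rfl⟩ ⟨j, rfl⟩
      simp [hν])
  have hb0 : b 0 = ν := hb 0 rfl
  let e2 : (Fin (n + 1) → ℝ) ≃ᵐ ℝ × (Fin n → ℝ) :=
    MeasurableEquiv.piFinSuccAbove (fun _ => ℝ) 0
  let e3 : ℝ × (Fin n → ℝ) ≃ᵐ ℝ × Eu n :=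
    MeasurableEquiv.prodCongr (MeasurableEquiv.refl ℝ) (MeasurableEquiv.toLp 2 (Fin n → ℝ))
  refine ⟨b.measurableEquiv.trans ((MeasurableEquiv.toLp 2 (Fin (n + 1) → ℝ)).symm.trans
    (e2.trans e3)), ?_, ?_, ?_⟩
  · have h3 : MeasurePreserving e3 volume volume :=
      (MeasurePreserving.id volume).prod
        (EuclideanSpace.volume_preserving_symm_measurableEquiv_toLp (Fin n)).symm
    exact ((h3.comp (volume_preserving_piFinSuccAbove (fun _ => ℝ) 0)).comp
      (EuclideanSpace.volume_preserving_symm_measurableEquiv_toLp (Fin (n + 1)))).comp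
      b.measurePreserving_measurableEquiv
  · intro w
    change b.repr w 0 = _
    rw [b.repr_apply_apply, hb0]
  · intro w
    rw [← b.repr.norm_map w, EuclideanSpace.norm_sq_eq, EuclideanSpace.norm_sq_eq, Fin.sum_univ_succ]
    simp only [Real.norm_eq_abs, sq_abs]
    rfl

/-- Polar coordinates in the n transversal variables. For n = 0 the integral is over a point of mass
one, which accounts for the convention C_{1,α} = 1. -/
lemma CN_eq_integral (n : ℕ) (α : ℝ) :
    CN (n + 1) α = ∫ z : Eu n, (1 + ‖z‖ ^ 2) ^ (-(((n : ℝ) + 1 + α) / 2)) := by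
  rcases n with _ | n
  · have h : volume (univ : Set (Eu 0)) = 1 := by
      rw [← (PiLp.volume_preserving_toLp (Fin 0)).measure_preimage
        MeasurableSet.univ.nullMeasurableSet, preimage_univ, volume_pi, Measure.pi_univ]
      simp
    rw [integral_unique, measureReal_def, h]
    have hn : ∀ z : Eu 0, ‖z‖ = 0 := fun z => by rw [Subsingleton.elim z 0, norm_zero]
    simp [CN, hn]
  · rw [integral_fun_norm_addHaar volume fun t : ℝ => (1 + t ^ 2) ^ (-((((n + 1 : ℕ) : ℝ) + 1 + α) / 2))]
    simp only [finrank_euclideanSpace, Fintype.card_fin, CN, omega, calI, smul_eq_mul, nsmul_eq_mul]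
    rw [if_neg (by omega)]
    push_cast
    simp only [add_sub_cancel_right, mul_assoc]
    ring_nf

/-! ### Boundary distance and supporting half-spaces -/

/-- A point of Ω has its distance to the complement attained on the frontier. -/
lemma infDist_frontier_le {N : ℕ} {Ω : Set (Eu N)} {x w : Eu N} (hx : x ∈ Ω) (hw : w ∉ Ω) :
    bdist Ω x ≤ dist x w := by
  obtain ⟨y, hy, hd⟩ := exists_mem_frontier_infDist_compl_eq_dist hx
    (fun h => hw (h ▸ mem_univ w))
  calc bdist Ω x ≤ dist x y := Metric.infDist_le_dist_of_mem hy
    _ = Metric.infDist x Ωᶜ := hd.symm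
    _ ≤ dist x w := Metric.infDist_le_dist_of_mem hw

lemma frontier_nonempty {N : ℕ} {Ω : Set (Eu N)} (h : Ω.Nonempty) (hΩ : Ω ≠ univ) :
    (frontier Ω).Nonempty := by
  obtain ⟨x, hx⟩ := h
  obtain ⟨y, hy, -⟩ := exists_mem_frontier_infDist_compl_eq_dist hx hΩ
  exact ⟨y, hy⟩

lemma bdist_pos {N : ℕ} {Ω : Set (Eu N)} (hΩo : IsOpen Ω) (hΩ : Ω ≠ univ) {x : Eu N}
    (hx : x ∈ Ω) : 0 < bdist Ω x := by
  refine (isClosed_frontier.notMem_iff_infDist_pos (frontier_nonempty ⟨x, hx⟩ hΩ)).1 ?_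
  rw [hΩo.frontier_eq]
  exact fun h => h.2 hx

/-- The distance of a point to a half-space's boundary bounds the distance to any boundary
inside it. -/
lemma bdist_le_of_subset_halfSpace {N : ℕ} {Ω : Set (Eu N)} {ν : Eu N} (hν : ‖ν‖ = 1) {c : ℝ}
    (hsub : ∀ y ∈ Ω, c < inner ℝ ν y) {y : Eu N} (hy : y ∈ Ω) :
    bdist Ω y ≤ inner ℝ ν y - c := by
  -- The foot of the perpendicular from y to the bounding hyperplane, which misses Ω.
  have hw : y - (inner ℝ ν y - c) • ν ∉ Ω := fun h => by
    have := hsub _ h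
    rw [inner_sub_right, inner_smul_right, real_inner_self_eq_norm_sq, hν] at this
    linarith
  have h := infDist_frontier_le hy hw
  rw [dist_eq_norm, sub_sub_cancel, norm_smul, hν, mul_one, Real.norm_eq_abs,
    abs_of_pos (by linarith [hsub y hy])] at h
  exact h

/-- Supporting half-spaces realise the boundary distance of a convex set at a given point. -/
lemma exists_supporting_halfSpace {N : ℕ} {Ω : Set (Eu N)} (hΩo : IsOpen Ω) (hΩc : Convex ℝ Ω)
    (hΩ : Ω ≠ univ) {x : Eu N} (hx : x ∈ Ω) :
    ∃ (ν : Eu N) (c : ℝ), ‖ν‖ = 1 ∧ (∀ y ∈ Ω, c < inner ℝ ν y) ∧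
      bdist Ω x = inner ℝ ν x - c := by
  obtain ⟨z, hz, hd⟩ := isClosed_frontier.exists_infDist_eq_dist (frontier_nonempty ⟨x, hx⟩ hΩ) x
  have hzΩ : z ∉ Ω := by
    rw [hΩo.frontier_eq] at hz
    exact hz.2
  obtain ⟨f, hf⟩ := geometric_hahn_banach_open_point hΩc hΩo hzΩ
  set μ : Eu N := -(InnerProductSpace.toDual ℝ (Eu N)).symm f with hμ
  have hμf : ∀ y, inner ℝ μ y = -f y := fun y => by
    rw [hμ, inner_neg_left, InnerProductSpace.toDual_symm_apply]
  have hμ0 : 0 < ‖μ‖ := by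
    rw [norm_pos_iff]
    intro h0
    have h1 := hμf x
    have h2 := hμf z
    rw [h0, inner_zero_left] at h1 h2
    linarith [hf x hx]
  have hν : ‖(‖μ‖⁻¹ • μ)‖ = 1 := by
    rw [norm_smul, norm_inv, norm_norm, inv_mul_cancel₀ hμ0.ne']
  have hsub : ∀ y ∈ Ω, inner ℝ (‖μ‖⁻¹ • μ) z < inner ℝ (‖μ‖⁻¹ • μ) y := fun y hy => by
    rw [real_inner_smul_left, real_inner_smul_left, hμf, hμf]
    exact mul_lt_mul_of_pos_left (neg_lt_neg (hf y hy)) (inv_pos.2 hμ0)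
  -- The hyperplane passes through z, a nearest frontier point to x. The reverse inequality is
  -- Cauchy–Schwarz applied to x - z.
  refine ⟨‖μ‖⁻¹ • μ, inner ℝ (‖μ‖⁻¹ • μ) z, hν, hsub,
    le_antisymm (bdist_le_of_subset_halfSpace hν hsub hx) ?_⟩
  rw [bdist, hd, dist_eq_norm, ← inner_sub_right]
  simpa [hν] using real_inner_le_norm (‖μ‖⁻¹ • μ) (x - z)

lemma IsHalfSpace.exists_unit {N : ℕ} {Ω : Set (Eu N)} (h : IsHalfSpace Ω) :
    ∃ (ν : Eu N) (c : ℝ), ‖ν‖ = 1 ∧ Ω = {x | c < inner ℝ ν x} := by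
  obtain ⟨μ, hμ, c, rfl⟩ := h
  have hμ0 : 0 < ‖μ‖ := norm_pos_iff.2 hμ
  refine ⟨‖μ‖⁻¹ • μ, ‖μ‖⁻¹ * c, ?_, ?_⟩
  · rw [norm_smul, norm_inv, norm_norm, inv_mul_cancel₀ hμ0.ne']
  · ext x
    simp only [mem_ofPred_eq, real_inner_smul_left]
    exact (mul_lt_mul_iff_right₀ (inv_pos.2 hμ0)).symm

lemma bdist_halfSpace {N : ℕ} {ν : Eu N} (hν : ‖ν‖ = 1) {c : ℝ} {x : Eu N}
    (hx : c < inner ℝ ν x) : bdist {x | c < inner ℝ ν x} x = inner ℝ ν x - c := by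
  refine le_antisymm (bdist_le_of_subset_halfSpace (Ω := {x | c < inner ℝ ν x}) hν
    (fun y hy => hy) hx) ?_
  have hΩ : {x : Eu N | c < inner ℝ ν x} ≠ univ := fun h => by
    have : (c - 1) • ν ∈ {x : Eu N | c < inner ℝ ν x} := h ▸ mem_univ _
    rw [mem_ofPred_eq, inner_smul_right, real_inner_self_eq_norm_sq, hν] at this
    linarith
  have hΩo : IsOpen {x : Eu N | c < inner ℝ ν x} := isOpen_lt (by fun_prop) (by fun_prop)
  refine (Metric.le_infDist (frontier_nonempty ⟨x, hx⟩ hΩ)).2 fun y hy => ?_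
  rw [hΩo.frontier_eq] at hy
  have hy' : inner ℝ ν y ≤ c := not_lt.1 hy.2
  have := real_inner_le_norm ν (x - y)
  rw [inner_sub_right, hν, one_mul] at this
  rw [dist_eq_norm]
  linarith

lemma distPow_halfSpace {N : ℕ} {ν : Eu N} (hν : ‖ν‖ = 1) (c β : ℝ) (x : Eu N) :
    distPow {x | c < inner ℝ ν x} β x = posPow β (inner ℝ ν x - c) := by
  by_cases hx : c < inner ℝ ν x
  · rw [posPow_of_pos (sub_pos.2 hx), distPow, indicator_of_mem (show x ∈ {x | c < inner ℝ ν x} from hx),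
      bdist_halfSpace hν hx]
  · rw [posPow_of_nonpos (by linarith), distPow, indicator_of_notMem]
    exact hx

/-- The restriction to β ≥ 0 in the convex case comes from here: `t ^ β` must be nondecreasing in t.
-/
lemma distPow_le_posPow {N : ℕ} {Ω : Set (Eu N)} (hΩo : IsOpen Ω) (hΩ : Ω ≠ univ) {ν : Eu N}
    (hν : ‖ν‖ = 1) {c : ℝ} (hsub : ∀ y ∈ Ω, c < inner ℝ ν y) {β : ℝ} (hβ : 0 ≤ β) (y : Eu N) :
    distPow Ω β y ≤ posPow β (inner ℝ ν y - c) := by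
  by_cases hy : y ∈ Ω
  · rw [distPow, indicator_of_mem hy, posPow_of_pos (sub_pos.2 (hsub y hy))]
    exact Real.rpow_le_rpow (bdist_pos hΩo hΩ hy).le (bdist_le_of_subset_halfSpace hν hsub hy) hβ
  · rw [distPow, indicator_of_notMem hy]
    exact posPow_nonneg _ _

lemma distPow_nonneg {N : ℕ} (Ω : Set (Eu N)) (β : ℝ) (x : Eu N) : 0 ≤ distPow Ω β x :=
  indicator_nonneg (fun _ _ => Real.rpow_nonneg Metric.infDist_nonneg _) x

lemma measurable_distPow {N : ℕ} {Ω : Set (Eu N)} (hΩo : IsOpen Ω) (β : ℝ) :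
    Measurable (distPow Ω β) := by
  refine Measurable.indicator ?_ hΩo.measurableSet
  unfold bdist
  exact (Metric.continuous_infDist_pt _).measurable.pow_const β

/-! ### The one-dimensional principal value -/

lemma exists_rpow_bound (q : ℝ) {m : ℝ} (M : ℝ) (hm : 0 < m) :
    ∃ C, 0 ≤ C ∧ ∀ t ∈ Icc m M, t ^ q ≤ C := by
  obtain ⟨C, hC⟩ := (isCompact_Icc (a := m) (b := M)).exists_bound_of_continuousOn
    (f := fun t : ℝ => t ^ q)
    (fun t ht => (Real.continuousAt_rpow_const _ _ (Or.inl (hm.trans_le ht.1).ne')).continuousWithinAt)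
  exact ⟨max C 0, le_max_right _ _,
    fun t ht => (le_abs_self _).trans ((hC t ht).trans (le_max_left _ _))⟩

lemma exists_rpow_lipschitz (β : ℝ) {m : ℝ} (M : ℝ) (hm : 0 < m) :
    ∃ L, 0 ≤ L ∧ ∀ t ∈ Icc m M, ∀ r ∈ Icc m M, |t ^ β - r ^ β| ≤ L * |t - r| := by
  obtain ⟨C, hC0, hC⟩ := exists_rpow_bound (β - 1) M hm
  refine ⟨|β| * C, by positivity, fun t ht r hr => ?_⟩
  refine (convex_Icc m M).norm_image_sub_le_of_norm_hasDerivWithin_le (f := fun t : ℝ => t ^ β)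
    (f' := fun t => β * t ^ (β - 1)) (fun x hx =>
      (Real.hasDerivAt_rpow_const (Or.inl (hm.trans_le hx.1).ne')).hasDerivWithinAt)
    (fun x hx => ?_) hr ht
  rw [norm_mul, Real.norm_eq_abs, Real.norm_eq_abs,
    abs_of_nonneg (Real.rpow_nonneg (hm.le.trans hx.1) _)]
  exact mul_le_mul_of_nonneg_left (hC x hx) (abs_nonneg _)

lemma posPow_rpow {r : ℝ} (hr : 0 < r) (β t : ℝ) : posPow β t ^ r = posPow (β * r) t := by
  rcases le_or_gt t 0 with h | h
  · rw [posPow_of_nonpos h, posPow_of_nonpos h, Real.zero_rpow hr.ne']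
  · rw [posPow_of_pos h, posPow_of_pos h, Real.rpow_mul h.le]

/-- The one-dimensional kernel on `(0,1)`. -/
def kern (p α β t : ℝ) : ℝ := Jp p (1 - t ^ β) / (1 - t) ^ (1 + α)

/-- The one-dimensional profile kernel on the line. -/
def lineKern (p α β t : ℝ) : ℝ := Jp p (1 - posPow β t) / |t - 1| ^ (1 + α)

lemma measurable_kern (p α β : ℝ) : Measurable (kern p α β) := by
  unfold kern; fun_prop

lemma abs_kern_le {p α β : ℝ} (hp : 1 < p) (hα : 0 < α) {b t : ℝ} (ht0 : 0 < t) (htb : t ≤ b)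
    (hb : b < 1) :
    |kern p α β t| ≤ 2 ^ (p - 1) / (1 - b) ^ (1 + α) * (1 + t ^ (β * (p - 1))) := by
  rw [kern, abs_div, abs_of_pos (a := (1 - t) ^ (1 + α)) (Real.rpow_pos_of_pos (by linarith) _),
    div_mul_eq_mul_div]
  have h := abs_Jp_sub_le hp 1 (t ^ β)
  rw [abs_one, Real.one_rpow, abs_of_nonneg (Real.rpow_nonneg ht0.le _),
    ← Real.rpow_mul ht0.le] at h
  refine div_le_div₀ (by positivity) h (Real.rpow_pos_of_pos (by linarith) _) ?_
  exact Real.rpow_le_rpow (by linarith) (by linarith) (by linarith)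

lemma integrableOn_kern_mul {p α β q : ℝ} (hp : 1 < p) (hα : 0 < α) (hq : -1 < q)
    (hq' : -1 < β * (p - 1) + q) {b : ℝ} (hb : b < 1) :
    IntegrableOn (fun t => kern p α β t * t ^ q) (Ioo 0 b) := by
  rcases le_or_gt b 0 with hb0 | hb0
  · rw [Ioo_eq_empty (not_lt.2 hb0)]; exact integrableOn_empty
  have h1 := (intervalIntegral.integrableOn_Ioo_rpow_iff hb0).2 hq
  have h2 := (intervalIntegral.integrableOn_Ioo_rpow_iff hb0).2 hq'
  refine ((h1.add h2).const_mul (2 ^ (p - 1) / (1 - b) ^ (1 + α))).mono'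
    ((measurable_kern p α β).mul (by fun_prop)).aestronglyMeasurable ?_
  refine (ae_restrict_iff' measurableSet_Ioo).2 (ae_of_all _ fun t ht => ?_)
  have hk := abs_kern_le (β := β) hp hα ht.1 ht.2.le hb
  have hnn : 0 ≤ t ^ q := Real.rpow_nonneg ht.1.le _
  rw [norm_mul, Real.norm_eq_abs, Real.norm_eq_abs, abs_of_nonneg hnn, Pi.add_apply,
    Real.rpow_add ht.1]
  calc |kern p α β t| * t ^ q ≤ _ := mul_le_mul_of_nonneg_right hk hnn
    _ = _ := by ring

lemma integrableOn_kern {p α β : ℝ} (hp : 1 < p) (hα : 0 < α) (hβ : -1 < β * (p - 1))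
    {b : ℝ} (hb : b < 1) : IntegrableOn (kern p α β) (Ioo 0 b) := by
  have := integrableOn_kern_mul (q := 0) hp hα (by norm_num) (by linarith : -1 < β * (p - 1) + 0) hb
  simpa using this

lemma abs_kern_le_near_one {p α β : ℝ} (hp : 1 < p) :
    ∃ C, 0 ≤ C ∧ ∀ t ∈ Ico (1 / 2 : ℝ) 1,
      |kern p α β t| ≤ C * ((1 - t) ^ (p - 1) / (1 - t) ^ (1 + α)) := by
  obtain ⟨L, hL0, hL⟩ := exists_rpow_lipschitz β (m := 1 / 2) 1 (by norm_num)
  refine ⟨L ^ (p - 1), by positivity, fun t ht => ?_⟩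
  have h1t : 0 < 1 - t := by linarith [ht.2]
  have h := hL 1 ⟨by norm_num, le_rfl⟩ t ⟨ht.1, ht.2.le⟩
  rw [Real.one_rpow, abs_of_pos h1t] at h
  rw [kern, abs_div, abs_Jp hp, abs_of_pos (a := (1 - t) ^ (1 + α)) (by positivity),
    ← mul_div_assoc, ← Real.mul_rpow hL0 h1t.le]
  have : 0 ≤ p - 1 := by linarith
  gcongr

/-- Near 0 the two bounds on β make each term integrable. Near 1 the second factor gains one power
of 1 - t, so the product is O((1-t)^(p-1-α)), integrable because α < p. -/
lemma integrableOn_lamIntegrand {p α β : ℝ} (hp : 1 < p) (hα : 0 < α) (hαp : α < p)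
    (hβ : -1 < β * (p - 1)) (hβ' : β * (p - 1) < α) :
    IntegrableOn (fun t => kern p α β t * (1 - t ^ (α - 1 - β * (p - 1)))) (Ioo 0 1) := by
  set q := α - 1 - β * (p - 1)
  rw [← Ioo_union_Ico_eq_Ioo (b := (1 / 2 : ℝ)) (by norm_num) (by norm_num)]
  refine IntegrableOn.union ?_ ?_
  · have := (integrableOn_kern hp hα hβ (b := 1 / 2) (by norm_num)).sub
      (integrableOn_kern_mul (q := q) hp hα (by simp only [q]; linarith)
        (by simp only [q]; linarith) (b := 1 / 2) (by norm_num))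
    refine this.congr_fun (fun t _ => ?_) measurableSet_Ioo
    simp only [Pi.sub_apply]; ring
  · obtain ⟨C, hC0, hC⟩ := abs_kern_le_near_one (α := α) (β := β) hp
    obtain ⟨L, hL0, hL⟩ := exists_rpow_lipschitz q (m := 1 / 2) 1 (by norm_num)
    have hint : IntegrableOn (fun t : ℝ => (1 - t) ^ (p - 1 - α)) (Ico (1 / 2) 1) := by
      have h := (intervalIntegral.integrableOn_Ioo_rpow_iff (s := p - 1 - α)
        (t := 1) (by norm_num)).2 (by linarith)
      rw [← (Measure.measurePreserving_sub_left volume (1 : ℝ)).integrableOn_comp_preimage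
        (MeasurableEquiv.subLeft (1 : ℝ)).measurableEmbedding] at h
      rw [integrableOn_Ico_iff_integrableOn_Ioo]
      refine h.mono_set fun t ht => ?_
      simp only [mem_preimage, mem_Ioo] at ht ⊢
      constructor <;> linarith [ht.1, ht.2]
    refine (hint.const_mul (C * L)).mono'
      ((measurable_kern p α β).mul (by fun_prop)).aestronglyMeasurable ?_
    refine (ae_restrict_iff' measurableSet_Ico).2 (ae_of_all _ fun t ht => ?_)
    have h1t : 0 < 1 - t := by linarith [ht.2]
    have h2 := hL 1 ⟨by norm_num, le_rfl⟩ t ⟨ht.1, ht.2.le⟩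
    rw [Real.one_rpow, abs_of_pos h1t] at h2
    rw [norm_mul, Real.norm_eq_abs, Real.norm_eq_abs]
    calc |kern p α β t| * |1 - t ^ q| ≤ C * ((1 - t) ^ (p - 1) / (1 - t) ^ (1 + α)) * (L * (1 - t)) :=
          mul_le_mul (hC t ht) h2 (abs_nonneg _) (by positivity)
      _ = C * L * ((1 - t) ^ (p - 1) / (1 - t) ^ (1 + α) * (1 - t) ^ (1 : ℝ)) := by
          rw [Real.rpow_one]; ring
      _ = C * L * (1 - t) ^ (p - 1 - α) := by
          rw [← Real.rpow_sub h1t, ← Real.rpow_add h1t]; congr 2; ring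

lemma lineKern_of_nonpos {p α β t : ℝ} (ht : t ≤ 0) :
    lineKern p α β t = (1 - t) ^ (-(1 + α)) := by
  rw [lineKern, posPow_of_nonpos ht, abs_sub_comm, abs_of_pos (by linarith : 0 < 1 - t),
    Real.rpow_neg (by linarith)]
  simp [Jp]

lemma lineKern_of_mem_Ioo {p α β t : ℝ} (ht : t ∈ Ioo (0 : ℝ) 1) :
    lineKern p α β t = kern p α β t := by
  rw [lineKern, posPow_of_pos ht.1, abs_sub_comm, abs_of_pos (by linarith [ht.2]), kern]

lemma lineKern_inv {p α β t : ℝ} (ht : t ∈ Ioo (0 : ℝ) 1) :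
    t ^ (-2 : ℝ) * lineKern p α β t⁻¹ = -(kern p α β t * t ^ (α - 1 - β * (p - 1))) := by
  have h0 : 0 < t := ht.1
  have h1 : 0 < 1 - t := by linarith [ht.2]
  have e1 : 1 - (t⁻¹) ^ β = t ^ (-β) * -(1 - t ^ β) := by
    rw [Real.inv_rpow h0.le, Real.rpow_neg h0.le]
    field_simp
    ring
  have e2 : |t⁻¹ - 1| = t⁻¹ * (1 - t) := by
    rw [abs_of_pos (sub_pos.2 (one_lt_inv_iff₀.2 ⟨h0, ht.2⟩))]
    field_simp
  rw [lineKern, posPow_of_pos (inv_pos.2 h0), e1, Jp_mul p (by positivity), Jp_neg, e2,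
    Real.mul_rpow (inv_nonneg.2 h0.le) h1.le, Real.inv_rpow h0.le, ← Real.rpow_mul h0.le, kern]
  have e3 : α - 1 - β * (p - 1) = -2 + -β * (p - 1) + (1 + α) := by ring
  rw [e3, Real.rpow_add h0 (-2 + -β * (p - 1)), Real.rpow_add h0 (-2)]
  have hc : 0 < t ^ (1 + α) := by positivity
  have hD : 0 < (1 - t) ^ (1 + α) := by positivity
  generalize t ^ (1 + α) = c at *
  generalize (1 - t) ^ (1 + α) = D at *
  generalize t ^ (-2 : ℝ) = a
  generalize t ^ (-β * (p - 1)) = b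
  field_simp

lemma integrableOn_lineKern_Iic {p α β : ℝ} (hα : 0 < α) :
    IntegrableOn (lineKern p α β) (Iic 0) ∧ ∫ t in Iic (0 : ℝ), lineKern p α β t = 1 / α := by
  have hmp := Measure.measurePreserving_sub_left volume (1 : ℝ)
  have hemb := (MeasurableEquiv.subLeft (1 : ℝ)).measurableEmbedding
  have hpre : (fun t : ℝ => 1 - t) ⁻¹' Ici 1 = Iic 0 := by ext t; simp
  have hint : IntegrableOn (fun t : ℝ => t ^ (-(1 + α))) (Ici 1) :=
    (integrableOn_Ici_iff_integrableOn_Ioi (by simp)).2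
      (integrableOn_Ioi_rpow_of_lt (by linarith) (by norm_num))
  constructor
  · rw [← hmp.integrableOn_comp_preimage hemb, hpre] at hint
    exact hint.congr_fun (fun t ht => (lineKern_of_nonpos ht).symm) measurableSet_Iic
  · rw [setIntegral_congr_fun measurableSet_Iic fun t ht => lineKern_of_nonpos ht, ← hpre,
      hmp.setIntegral_preimage_emb hemb (fun t : ℝ => t ^ (-(1 + α))), integral_Ici_eq_integral_Ioi,
      integral_Ioi_rpow_of_lt (by linarith) (by norm_num)]
    rw [Real.one_rpow, show -(1 + α) + 1 = -α by ring, neg_div_neg_eq]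

lemma integrableOn_lineKern_Ioi {p α β : ℝ} (hp : 1 < p) (hα : 0 < α)
    (hβ' : β * (p - 1) < α) {δ : ℝ} (hδ : 0 < δ) :
    IntegrableOn (lineKern p α β) (Ioi (1 + δ)) ∧ ∫ t in Ioi (1 + δ), lineKern p α β t =
      -∫ t in Ioo 0 (1 + δ)⁻¹, kern p α β t * t ^ (α - 1 - β * (p - 1)) := by
  have h1δ : (1 + δ)⁻¹ < 1 := inv_lt_one_of_one_lt₀ (by linarith)
  set h := (Ioi (1 + δ)).indicator (lineKern p α β) with hh
  -- The inversion is the power substitution with exponent -1, applied to the kernel cut off to t >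
  -- 1 + δ.
  have key : EqOn (fun x : ℝ => (|(-1 : ℝ)| * x ^ ((-1 : ℝ) - 1)) • h (x ^ (-1 : ℝ)))
      ((Ioo 0 (1 + δ)⁻¹).indicator
        fun t => -(kern p α β t * t ^ (α - 1 - β * (p - 1)))) (Ioi 0) := by
    intro x hx
    have hx : 0 < x := hx
    simp only [abs_neg, abs_one, one_mul, Real.rpow_neg_one, smul_eq_mul]
    by_cases hxd : x < (1 + δ)⁻¹
    · have hm : x⁻¹ ∈ Ioi (1 + δ) := (lt_inv_comm₀ (by linarith) hx).2 hxd
      rw [hh, indicator_of_mem hm, indicator_of_mem (show x ∈ Ioo 0 (1 + δ)⁻¹ from ⟨hx, hxd⟩),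
        ← lineKern_inv ⟨hx, hxd.trans h1δ⟩]
      norm_num
    · have hm : x⁻¹ ∉ Ioi (1 + δ) := fun hc => hxd ((lt_inv_comm₀ (by linarith) hx).1 hc)
      rw [hh, indicator_of_notMem hm, indicator_of_notMem fun hc => hxd hc.2, mul_zero]
  have hsub : Ioi (1 + δ) ∩ Ioi 0 = Ioi (1 + δ) :=
    inter_eq_left.2 (Ioi_subset_Ioi (by linarith))
  have hsub' : Ioo 0 (1 + δ)⁻¹ ∩ Ioi 0 = Ioo 0 (1 + δ)⁻¹ :=
    inter_eq_left.2 fun x hx => hx.1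
  constructor
  · have hi := integrableOn_Ioi_comp_rpow_iff h (p := -1) (by norm_num)
    rw [integrableOn_congr_fun key measurableSet_Ioi, IntegrableOn,
      integrable_indicator_iff measurableSet_Ioo, IntegrableOn, Measure.restrict_restrict
      measurableSet_Ioo, hsub', IntegrableOn, integrable_indicator_iff measurableSet_Ioi,
      IntegrableOn, Measure.restrict_restrict measurableSet_Ioi, hsub] at hi
    exact hi.1 (integrableOn_kern_mul hp hα (by linarith) (by linarith) h1δ).neg
  · have hi := integral_comp_rpow_Ioi h (p := -1) (by norm_num)
    rw [setIntegral_congr_fun measurableSet_Ioi key, setIntegral_indicator measurableSet_Ioo,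
      hh, setIntegral_indicator measurableSet_Ioi, inter_comm, hsub', inter_comm, hsub,
      integral_neg] at hi
    exact hi.symm

lemma setOf_lt_abs_sub_one {δ : ℝ} (hδ1 : δ < 1) :
    {t : ℝ | δ < |t - 1|} = (Iic 0 ∪ Ioo 0 (1 - δ)) ∪ Ioi (1 + δ) := by
  rw [Iic_union_Ioo_eq_Iio (by linarith)]
  ext t
  simp only [mem_ofPred_eq, lt_abs, mem_union, mem_Iio, mem_Ioi]
  constructor
  · rintro (h | h)
    · right; linarith
    · left; linarith
  · rintro (h | h)
    · right; linarith
    · left; linarith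

/-- Inversion sends (1+δ, ∞) to (0, 1/(1+δ)), which slightly exceeds the other truncated piece (0,
1-δ). The mismatch is the last term. -/
lemma lineKern_split {p α β : ℝ} (hp : 1 < p) (hα : 0 < α)
    (hβ : -1 < β * (p - 1)) (hβ' : β * (p - 1) < α) {δ : ℝ} (hδ : 0 < δ) (hδ1 : δ < 1) :
    IntegrableOn (lineKern p α β) {t | δ < |t - 1|} ∧
    ∫ t in {t | δ < |t - 1|}, lineKern p α β t =
      1 / α + (∫ t in Ioo 0 (1 - δ), kern p α β t * (1 - t ^ (α - 1 - β * (p - 1)))) -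
        ∫ t in Ico (1 - δ) (1 + δ)⁻¹, kern p α β t * t ^ (α - 1 - β * (p - 1)) := by
  set q := α - 1 - β * (p - 1) with hq
  obtain ⟨i1, e1⟩ := integrableOn_lineKern_Iic (p := p) (β := β) hα
  obtain ⟨i3, e3⟩ := integrableOn_lineKern_Ioi (p := p) (β := β) hp hα hβ' hδ
  have h1δ : (1 + δ)⁻¹ < 1 := inv_lt_one_of_one_lt₀ (by linarith)
  have hle : 1 - δ ≤ (1 + δ)⁻¹ := by
    rw [le_inv_comm₀ (by linarith) (by linarith), ← sub_nonneg]
    rw [show (1 - δ)⁻¹ - (1 + δ) = δ ^ 2 * (1 - δ)⁻¹ by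
      have : 1 - δ ≠ 0 := by linarith
      field_simp; ring]
    have : 0 < (1 - δ)⁻¹ := inv_pos.2 (by linarith)
    positivity
  have hEq : EqOn (kern p α β) (lineKern p α β) (Ioo 0 (1 - δ)) := fun t ht =>
    (lineKern_of_mem_Ioo ⟨ht.1, by linarith [ht.2]⟩).symm
  have hk := integrableOn_kern hp hα hβ (show 1 - δ < 1 by linarith)
  have i2 : IntegrableOn (lineKern p α β) (Ioo 0 (1 - δ)) := hk.congr_fun hEq measurableSet_Ioo
  have hkq : IntegrableOn (fun t => kern p α β t * t ^ q) (Ioo 0 (1 + δ)⁻¹) :=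
    integrableOn_kern_mul hp hα (by linarith) (by linarith) h1δ
  rw [setOf_lt_abs_sub_one hδ1]
  refine ⟨(i1.union i2).union i3, ?_⟩
  rw [setIntegral_union _ measurableSet_Ioi (i1.union i2) i3,
    setIntegral_union _ measurableSet_Ioo i1 i2, e1, e3, ← setIntegral_congr_fun measurableSet_Ioo hEq,
    ← Ioo_union_Ico_eq_Ioo (show 0 < 1 - δ by linarith) hle,
    setIntegral_union _ measurableSet_Ico (hkq.mono_set (Ioo_subset_Ioo_right hle))
      (hkq.mono_set (fun t ht => ⟨by linarith [ht.1], ht.2⟩))]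
  · have : ∫ t in Ioo 0 (1 - δ), kern p α β t * (1 - t ^ q) =
        (∫ t in Ioo 0 (1 - δ), kern p α β t) - ∫ t in Ioo 0 (1 - δ), kern p α β t * t ^ q := by
      rw [← integral_sub hk (hkq.mono_set (Ioo_subset_Ioo_right hle))]
      simp only [mul_sub, mul_one]
    rw [this]
    ring
  · exact Set.disjoint_left.2 fun t ht ht' => by linarith [ht.2, ht'.1]
  · exact Set.disjoint_left.2 fun t ht ht' => not_lt.2 ht ht'.1
  · refine Set.disjoint_left.2 fun t ht ht' => ?_
    have ht' : 1 + δ < t := ht'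
    rcases ht with ht | ht
    · have ht : t ≤ 0 := ht
      linarith
    · linarith [ht.2]

/-- On this interval 1 - t is comparable to δ, so the integrand is O(δ^(p-2-α)). The length is
O(δ²), and the product O(δ^(p-α)) vanishes since α < p. -/
lemma tendsto_remainder {p α β : ℝ} (hp : 1 < p) (hα : 0 < α) (hαp : α < p) (q : ℝ) :
    Tendsto (fun δ => ∫ t in Ico (1 - δ) (1 + δ)⁻¹, kern p α β t * t ^ q) (𝓝[>] 0) (𝓝 0) := by
  obtain ⟨C, hC0, hC⟩ := abs_kern_le_near_one (α := α) (β := β) hp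
  obtain ⟨D, hD0, hD⟩ := exists_rpow_bound q (m := 1 / 2) 1 (by norm_num)
  set E := C * (1 / 2 : ℝ) ^ (-(1 + α)) * D with hE
  have hlim : Tendsto (fun δ : ℝ => E * δ ^ (p - α)) (𝓝[>] 0) (𝓝 0) := by
    have : Tendsto (fun δ : ℝ => δ ^ (p - α)) (𝓝[>] 0) (𝓝 0) := by
      have h := (Real.continuousAt_rpow_const 0 (p - α) (Or.inr (by linarith))).tendsto
      rw [Real.zero_rpow (by linarith)] at h
      exact h.mono_left nhdsWithin_le_nhds
    simpa using this.const_mul E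
  refine squeeze_zero_norm' ?_ hlim
  filter_upwards [Ioo_mem_nhdsGT (show (0 : ℝ) < 1 / 2 by norm_num)] with δ hδ
  have h0 : 0 < δ := hδ.1
  have h2 : δ < 1 / 2 := hδ.2
  -- Gives 1 - t ≥ δ/2 on the interval, hence the factor 1/2 in the denominator bound.
  have hinv : (1 + δ)⁻¹ ≤ 1 - δ / 2 := by
    rw [inv_le_iff_one_le_mul₀ (by linarith)]
    nlinarith
  have hbound : ∀ t ∈ Ico (1 - δ) (1 + δ)⁻¹, ‖kern p α β t * t ^ q‖ ≤
      E * δ ^ (p - 1 - (1 + α)) := fun t ht => by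
    have ht1 : t ∈ Ico (1 / 2 : ℝ) 1 := ⟨by linarith [ht.1], by linarith [ht.2]⟩
    have h1t : 0 < 1 - t := by linarith [ht1.2]
    rw [norm_mul, Real.norm_eq_abs, Real.norm_eq_abs,
      abs_of_nonneg (Real.rpow_nonneg (by linarith [ht1.1] : 0 ≤ t) q)]
    have hA : (1 - t) ^ (p - 1) / (1 - t) ^ (1 + α) ≤ δ ^ (p - 1) / (1 / 2 * δ) ^ (1 + α) := by
      apply div_le_div₀ (by positivity) _ (by positivity)
      · exact Real.rpow_le_rpow (by positivity) (by linarith [ht.2]) (by linarith)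
      · exact Real.rpow_le_rpow h1t.le (by linarith [ht.1]) (by linarith)
    calc |kern p α β t| * t ^ q
        ≤ C * (δ ^ (p - 1) / (1 / 2 * δ) ^ (1 + α)) * D :=
          mul_le_mul ((hC t ht1).trans (mul_le_mul_of_nonneg_left hA hC0))
            (hD t ⟨ht1.1, ht1.2.le⟩) (Real.rpow_nonneg (by linarith [ht1.1]) _) (by positivity)
      _ = E * δ ^ (p - 1 - (1 + α)) := by
          have hc : 0 < δ ^ (1 + α) := by positivity
          have hD' : 0 < (1 / 2 : ℝ) ^ (1 + α) := by positivity
          rw [Real.mul_rpow (by norm_num) h0.le, Real.rpow_sub h0 (p - 1), hE,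
            Real.rpow_neg (by norm_num)]
          generalize δ ^ (1 + α) = a at *
          generalize (1 / 2 : ℝ) ^ (1 + α) = b at *
          generalize δ ^ (p - 1) = c at *
          field_simp
  have hvol : volume.real (Ico (1 - δ) (1 + δ)⁻¹) ≤ δ ^ (2 : ℝ) := by
    rw [Real.volume_real_Ico, Real.rpow_two]
    refine max_le ?_ (by positivity)
    have : (1 + δ)⁻¹ ≤ 1 - δ + δ ^ 2 := by
      rw [inv_le_iff_one_le_mul₀ (by linarith)]
      nlinarith [pow_pos h0 3]
    linarith
  calc _ ≤ E * δ ^ (p - 1 - (1 + α)) * volume.real (Ico (1 - δ) (1 + δ)⁻¹) :=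
        norm_setIntegral_le_of_norm_le_const (by simp) hbound
    _ ≤ E * δ ^ (p - 1 - (1 + α)) * δ ^ (2 : ℝ) := by gcongr
    _ = E * δ ^ (p - α) := by
        rw [mul_assoc, ← Real.rpow_add h0]; congr 2; ring

/-- The truncated one-dimensional principal value. -/
def linePV (p α β δ : ℝ) : ℝ :=
  ∫ τ in {τ : ℝ | δ < |τ|}, Jp p (1 - posPow β (1 + τ)) / |τ| ^ (1 + α)

lemma linePV_eq (p α β δ : ℝ) :
    linePV p α β δ = ∫ t in {t | δ < |t - 1|}, lineKern p α β t := by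
  have hmp := measurePreserving_add_left volume (1 : ℝ)
  have hemb := (MeasurableEquiv.addLeft (1 : ℝ)).measurableEmbedding
  rw [← hmp.setIntegral_preimage_emb hemb]
  simp only [preimage_ofPred_eq, add_sub_cancel_left, linePV, lineKern]

lemma tendsto_linePV {p α β : ℝ} (hp : 1 < p) (hα : 0 < α) (hαp : α < p)
    (hβ : -1 < β * (p - 1)) (hβ' : β * (p - 1) < α) :
    Tendsto (linePV p α β) (𝓝[>] 0)
      (𝓝 ((∫ t in Ioo (0 : ℝ) 1, kern p α β t * (1 - t ^ (α - 1 - β * (p - 1)))) + 1 / α)) := by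
  set q := α - 1 - β * (p - 1) with hq
  have hint := integrableOn_lamIntegrand hp hα hαp hβ hβ'
  have h1 : Tendsto (fun δ : ℝ => ∫ t in Ioo 0 (1 - δ), kern p α β t * (1 - t ^ q)) (𝓝[>] 0)
      (𝓝 (∫ t in Ioo (0 : ℝ) 1, kern p α β t * (1 - t ^ q))) := by
    simp_rw [← integral_indicator measurableSet_Ioo]
    refine tendsto_integral_filter_of_dominated_convergence
      (fun t => ‖(Ioo 0 1).indicator (fun t => kern p α β t * (1 - t ^ q)) t‖) ?_ ?_
      (hint.integrable_indicator measurableSet_Ioo).norm ?_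
    · exact Eventually.of_forall fun δ => (((measurable_kern p α β).mul
        (by fun_prop)).indicator measurableSet_Ioo).aestronglyMeasurable
    · filter_upwards [self_mem_nhdsWithin] with δ hδ
      have hδ : 0 < δ := hδ
      refine ae_of_all _ fun t => ?_
      rw [norm_indicator_eq_indicator_norm, norm_indicator_eq_indicator_norm]
      exact indicator_le_indicator_of_subset (Ioo_subset_Ioo_right (by linarith))
        (fun _ => norm_nonneg _) t
    · refine ae_of_all _ fun t => tendsto_const_nhds.congr' ?_
      by_cases ht : t ∈ Ioo (0 : ℝ) 1
      · filter_upwards [Ioo_mem_nhdsGT (show (0 : ℝ) < 1 - t by linarith [ht.2])] with δ hδ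
        rw [indicator_of_mem ht, indicator_of_mem]
        exact ⟨ht.1, by linarith [hδ.2]⟩
      · filter_upwards [self_mem_nhdsWithin] with δ hδ
        have hδ : 0 < δ := hδ
        rw [indicator_of_notMem ht, indicator_of_notMem]
        exact fun h => ht ⟨h.1, by linarith [h.2]⟩
  have h2 := (h1.const_add (1 / α)).sub (tendsto_remainder (β := β) hp hα hαp q)
  rw [sub_zero, add_comm (1 / α)] at h2
  refine h2.congr' ?_
  filter_upwards [Ioo_mem_nhdsGT (zero_lt_one (α := ℝ))] with δ hδ
  rw [linePV_eq, (lineKern_split hp hα hβ hβ' hδ.1 hδ.2).2]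

/-- Small δ are controlled by convergence. For larger δ the truncated domain lies in a fixed set on
which the kernel is absolutely integrable. The uniform bound serves as dominating constant when
integrating over slices. -/
lemma exists_linePV_bound {p α β : ℝ} (hp : 1 < p) (hα : 0 < α) (hαp : α < p)
    (hβ : -1 < β * (p - 1)) (hβ' : β * (p - 1) < α) :
    ∃ B, 0 ≤ B ∧ ∀ δ, 0 < δ → |linePV p α β δ| ≤ B := by
  have h := (tendsto_linePV hp hα hαp hβ hβ').abs
  set l := |(∫ t in Ioo (0 : ℝ) 1, kern p α β t * (1 - t ^ (α - 1 - β * (p - 1)))) + 1 / α|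
  have h1 := h.eventually (gt_mem_nhds (show l < l + 1 by linarith))
  obtain ⟨δ₀, hδ₀, hsub⟩ := (mem_nhdsGT_iff_exists_Ioo_subset).1
    (inter_mem h1 (Ioo_mem_nhdsGT (zero_lt_one (α := ℝ))))
  -- Strictly below δ₀, so that every truncation with δ ≥ δ₀ is contained in the one at η; below 1,
  -- as `lineKern_split` requires.
  set η := min (δ₀ / 2) (1 / 2)
  have hδ₀ : 0 < δ₀ := hδ₀
  have hη : 0 < η := by positivity
  have hηδ : η < δ₀ := (min_le_left _ _).trans_lt (by linarith)
  have hη1 : η < 1 := (min_le_right _ _).trans_lt (by norm_num)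
  have hint := (lineKern_split hp hα hβ hβ' hη hη1).1
  refine ⟨max (l + 1) (∫ t in {t | η < |t - 1|}, |lineKern p α β t|), le_max_of_le_left
    (by positivity), fun δ hδ => ?_⟩
  rcases lt_or_ge δ δ₀ with hlt | hge
  · exact le_max_of_le_left (hsub ⟨hδ, hlt⟩).1.le
  · refine le_max_of_le_right ?_
    rw [linePV_eq]
    refine abs_integral_le_integral_abs.trans ?_
    refine setIntegral_mono_set hint.abs (ae_of_all _ fun t => abs_nonneg _) ?_
    exact LE.le.eventuallyLE fun t (ht : δ < |t - 1|) => (show η < |t - 1| by linarith)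

/-! ### Tails and integrability away from a point -/

/-- In the unit slab along the hyperplane a negative power is integrable across (γ > -1), and the
weight decays in the transversal directions. Beyond the slab the profile grows at most like a power
smaller than α. -/
lemma integrable_posPow_tail {n : ℕ} {ν : Eu (n + 1)} (hν : ‖ν‖ = 1) (c : ℝ) {γ α : ℝ}
    (hα : 0 < α) (hγ : -1 < γ) (hγα : γ < α) :
    Integrable fun x : Eu (n + 1) =>
      posPow γ (inner ℝ ν x - c) / (1 + ‖x‖) ^ (((n + 1 : ℕ) : ℝ) + α) := by
  set r : ℝ := ((n + 1 : ℕ) : ℝ) + α with hr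
  have hr0 : 0 < r := by positivity
  obtain ⟨Φ, hΦ, hΦ1, hΦ2⟩ := exists_slicing hν
  set S : ℝ → ℝ := (Ioc c (c + 1)).indicator fun τ => (τ - c) ^ γ with hS
  have hSint : Integrable S := by
    have h := (intervalIntegral.integrableOn_Ioo_rpow_iff (zero_lt_one (α := ℝ))).2 hγ
    have h' : IntegrableOn (fun τ : ℝ => τ ^ γ) (Ioc 0 1) :=
      (integrableOn_Ioc_iff_integrableOn_Ioo (by simp)).2 h
    rw [← (measurePreserving_sub_right volume c).integrableOn_comp_preimage
      (MeasurableEquiv.subRight c).measurableEmbedding] at h'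
    refine (integrable_indicator_iff measurableSet_Ioc).2 (h'.mono_set fun t ht => ?_)
    simp only [mem_preimage, mem_Ioc] at ht ⊢
    constructor <;> linarith [ht.1, ht.2]
  have hZ : Integrable fun z : Eu n => (1 + ‖z‖) ^ (-r) := by
    refine integrable_one_add_norm ?_
    rw [hr, finrank_euclideanSpace, Fintype.card_fin]
    push_cast
    linarith
  have h1 : Integrable fun x : Eu (n + 1) => S (Φ x).1 * (1 + ‖(Φ x).2‖) ^ (-r) :=
    (hΦ.integrable_comp_emb Φ.measurableEmbedding).2 (hSint.mul_prod hZ)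
  -- A nonnegative growth exponent, so the distance may be replaced by its upper bound even when γ <
  -- 0.
  set g := max γ 0 with hg
  have h2 : Integrable fun x : Eu (n + 1) => (1 + |c|) ^ g * (1 + ‖x‖) ^ (-(r - g)) := by
    refine (integrable_one_add_norm ?_).const_mul _
    have : g < α := max_lt hγα hα
    rw [hr, finrank_euclideanSpace, Fintype.card_fin]
    linarith
  refine (h1.add h2).mono' (Measurable.aestronglyMeasurable (by fun_prop)) (ae_of_all _ fun x => ?_)
  have hx1 : 0 < 1 + ‖x‖ := by positivity
  rw [Real.norm_eq_abs, abs_of_nonneg (div_nonneg (posPow_nonneg _ _) (by positivity)),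
    Pi.add_apply, div_eq_mul_inv, ← Real.rpow_neg hx1.le]
  have hle : ‖(Φ x).2‖ ≤ ‖x‖ := by
    refine le_of_sq_le_sq ?_ (norm_nonneg _)
    rw [hΦ2 x]
    linarith [sq_nonneg (Φ x).1]
  have hS0 : 0 ≤ S (Φ x).1 := indicator_nonneg
    (fun τ hτ => Real.rpow_nonneg (by linarith [hτ.1]) _) _
  have hA : 0 ≤ S (Φ x).1 * (1 + ‖(Φ x).2‖) ^ (-r) := mul_nonneg hS0 (by positivity)
  have hB : 0 ≤ (1 + |c|) ^ g * (1 + ‖x‖) ^ (-(r - g)) := by positivity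
  rcases le_or_gt (inner ℝ ν x - c) 0 with h | h
  · rw [posPow_of_nonpos h, zero_mul]
    exact add_nonneg hA hB
  rw [posPow_of_pos h]
  rcases le_or_gt (inner ℝ ν x - c) 1 with h' | h'
  · have hm : (Φ x).1 ∈ Ioc c (c + 1) := by
      rw [hΦ1]; constructor <;> linarith
    refine le_add_of_le_of_nonneg ?_ hB
    rw [hS, indicator_of_mem hm, hΦ1]
    refine mul_le_mul_of_nonneg_left ?_ (by positivity)
    exact Real.rpow_le_rpow_of_nonpos (by positivity) (by linarith) (by linarith)
  · refine le_add_of_nonneg_of_le hA ?_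
    have hb : inner ℝ ν x - c ≤ (1 + |c|) * (1 + ‖x‖) := by
      have h1 := real_inner_le_norm ν x
      rw [hν, one_mul] at h1
      nlinarith [neg_abs_le c, abs_nonneg c, norm_nonneg x, mul_nonneg (abs_nonneg c) (norm_nonneg x)]
    calc (inner ℝ ν x - c) ^ γ * (1 + ‖x‖) ^ (-r)
        ≤ (inner ℝ ν x - c) ^ g * (1 + ‖x‖) ^ (-r) := by
          refine mul_le_mul_of_nonneg_right ?_ (by positivity)
          exact Real.rpow_le_rpow_of_exponent_le h'.le (le_max_left _ _)
      _ ≤ ((1 + |c|) * (1 + ‖x‖)) ^ g * (1 + ‖x‖) ^ (-r) := by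
          refine mul_le_mul_of_nonneg_right ?_ (by positivity)
          exact Real.rpow_le_rpow h.le hb (le_max_right _ _)
      _ = (1 + |c|) ^ g * (1 + ‖x‖) ^ (-(r - g)) := by
          rw [Real.mul_rpow (by positivity) hx1.le, mul_assoc, ← Real.rpow_add hx1]
          congr 2; ring

/-- For x bounded and y at distance more than ε from x, 1 + |y| is at most a constant times |x - y|,
so the kernel is dominated by the tail weight. -/
lemma inv_rpow_norm_sub_le {N : ℕ} {r R ε : ℝ} (hr : 0 ≤ r) (hε : 0 < ε) {x y : Eu N}
    (hx : ‖x‖ ≤ R) (hxy : ε < ‖x - y‖) :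
    (‖x - y‖ ^ r)⁻¹ ≤ ((1 + R) / ε + 1) ^ r * ((1 + ‖y‖) ^ r)⁻¹ := by
  have hR : 0 ≤ R := (norm_nonneg x).trans hx
  have hd : 0 < ‖x - y‖ := hε.trans hxy
  have hy : 1 + ‖y‖ ≤ ((1 + R) / ε + 1) * ‖x - y‖ := by
    have h1 : ‖y‖ ≤ ‖x‖ + ‖x - y‖ := by
      have := norm_sub_le x (x - y)
      rwa [sub_sub_cancel] at this
    have h2 : 1 + R ≤ (1 + R) / ε * ‖x - y‖ := by
      rw [div_mul_eq_mul_div, le_div_iff₀ hε]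
      exact mul_le_mul_of_nonneg_left hxy.le (by linarith)
    linarith
  have h := Real.rpow_le_rpow (by positivity) hy hr
  rw [Real.mul_rpow (by positivity) hd.le] at h
  rw [← div_eq_mul_inv, le_div_iff₀ (by positivity), inv_mul_le_iff₀ (by positivity)]
  linarith

lemma abs_far_le {N : ℕ} {p r R ε : ℝ} (hp : 1 < p) (hr : 0 ≤ r) (hε : 0 < ε) {x y : Eu N}
    (hx : ‖x‖ ≤ R) (hxy : ε < ‖x - y‖) (a b : ℝ) :
    |Jp p (a - b) / ‖x - y‖ ^ r| ≤ 2 ^ (p - 1) * ((1 + R) / ε + 1) ^ r *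
      (|a| ^ (p - 1) * ((1 + ‖y‖) ^ r)⁻¹ + |b| ^ (p - 1) / (1 + ‖y‖) ^ r) := by
  have hR : 0 ≤ R := (norm_nonneg x).trans hx
  rw [abs_div, abs_of_nonneg (a := ‖x - y‖ ^ r) (by positivity), div_eq_mul_inv]
  calc _ ≤ 2 ^ (p - 1) * (|a| ^ (p - 1) + |b| ^ (p - 1)) *
        (((1 + R) / ε + 1) ^ r * ((1 + ‖y‖) ^ r)⁻¹) :=
        mul_le_mul (abs_Jp_sub_le hp a b) (inv_rpow_norm_sub_le hr hε hx hxy) (by positivity)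
          (by positivity)
    _ = _ := by ring

lemma integrable_inv_one_add_norm_rpow {N : ℕ} {r : ℝ} (hr : (N : ℝ) < r) :
    Integrable fun y : Eu N => ((1 + ‖y‖) ^ r)⁻¹ := by
  have : Integrable fun y : Eu N => (1 + ‖y‖) ^ (-r) :=
    integrable_one_add_norm (by rwa [finrank_euclideanSpace, Fintype.card_fin])
  refine this.congr (ae_of_all _ fun y => ?_)
  exact Real.rpow_neg (by positivity) _

lemma measurableSet_far {N : ℕ} (x : Eu N) (ε : ℝ) : MeasurableSet {y : Eu N | ε < ‖x - y‖} :=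
  (isOpen_lt continuous_const (by fun_prop)).measurableSet

lemma integrableOn_far {N : ℕ} {p r : ℝ} (hp : 1 < p) (hr : (N : ℝ) < r) {u : Eu N → ℝ}
    (hu : Measurable u) (htail : Integrable fun y : Eu N => |u y| ^ (p - 1) / (1 + ‖y‖) ^ r)
    (x : Eu N) (a : ℝ) {ε : ℝ} (hε : 0 < ε) :
    IntegrableOn (fun y => Jp p (a - u y) / ‖x - y‖ ^ r) {y | ε < ‖x - y‖} := by
  have hr0 : 0 ≤ r := (Nat.cast_nonneg N).trans hr.le
  refine ((((integrable_inv_one_add_norm_rpow hr).const_mul (|a| ^ (p - 1))).add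
    htail).const_mul (2 ^ (p - 1) * ((1 + ‖x‖) / ε + 1) ^ r)).integrableOn.mono'
    (Measurable.aestronglyMeasurable (by fun_prop)) ?_
  refine (ae_restrict_iff' (measurableSet_far x ε)).2 (ae_of_all _ fun y hy => ?_)
  exact abs_far_le hp hr0 hε le_rfl hy a (u y)

/-! ### Half-space profiles and reduction to the line -/

/-- Anisotropic scaling in the second factor. -/
lemma integral_prod_scale {n : ℕ} {H : ℝ × Eu n → ℝ} (hm : Measurable H)
    (hH : Integrable H) :
    Integrable (fun q : ℝ × Eu n => |q.1| ^ n * H (q.1, |q.1| • q.2)) ∧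
      ∫ q : ℝ × Eu n, |q.1| ^ n * H (q.1, |q.1| • q.2) = ∫ q, H q := by
  have key : ∀ f : Eu n → ℝ, ∀ τ : ℝ, τ ≠ 0 →
      ∫ z, |τ| ^ n * f (|τ| • z) = ∫ z, f z := fun f τ hτ => by
    have h0 : 0 < |τ| := abs_pos.2 hτ
    rw [integral_const_mul, Measure.integral_comp_smul, finrank_euclideanSpace, Fintype.card_fin,
      abs_of_pos (a := (|τ| ^ n)⁻¹) (by positivity), smul_eq_mul, mul_inv_cancel_left₀ (by positivity)]
  -- The dilation by |τ| degenerates only on the null slice τ = 0.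
  have hne : ∀ᵐ τ : ℝ, τ ≠ 0 := Measure.ae_ne volume 0
  have hi : Integrable (fun q : ℝ × Eu n => |q.1| ^ n * H (q.1, |q.1| • q.2)) := by
    rw [Measure.volume_eq_prod, integrable_prod_iff (Measurable.aestronglyMeasurable (by fun_prop))]
    rw [Measure.volume_eq_prod, integrable_prod_iff hm.aestronglyMeasurable] at hH
    constructor
    · filter_upwards [hH.1, hne] with τ h hτ
      exact (h.comp_smul (abs_pos.2 hτ).ne').const_mul _
    · refine hH.2.congr ?_
      filter_upwards [hne] with τ hτ
      rw [← key (fun z => ‖H (τ, z)‖) τ hτ]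
      simp only [norm_mul, norm_pow, Real.norm_eq_abs, abs_abs]
  refine ⟨hi, ?_⟩
  rw [Measure.volume_eq_prod, integral_prod _ hi, integral_prod _ hH]
  refine integral_congr_ae ?_
  filter_upwards [hne] with τ hτ
  exact key (fun z => H (τ, z)) τ hτ

/-- The truncated principal value of the normalised half-space profile at distance one. -/
def halfPV {N : ℕ} (p α β : ℝ) (ν : Eu N) (ε : ℝ) : ℝ :=
  ∫ w in {w : Eu N | ε < ‖w‖},
    Jp p (1 - posPow β (1 + inner ℝ ν w)) / ‖w‖ ^ ((N : ℝ) + α)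

/-- With w = (τ, |τ|z) one has |w| = |τ|√(1+|z|²) and Jacobian |τ|^n. Each z-slice is thus a line
principal value, with cutoff rescaled by √(1+|z|²). The right-hand side no longer involves ν. -/
lemma halfPV_eq_slices {n : ℕ} {p α β : ℝ} (hp : 1 < p) (hα : 0 < α)
    (hβ : -1 < β * (p - 1)) (hβ' : β * (p - 1) < α) {ν : Eu (n + 1)} (hν : ‖ν‖ = 1)
    {ε : ℝ} (hε : 0 < ε) :
    Integrable (fun z : Eu n => (1 + ‖z‖ ^ 2) ^ (-(((n : ℝ) + 1 + α) / 2)) *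
      linePV p α β (ε / √(1 + ‖z‖ ^ 2))) ∧
    halfPV p α β ν ε = ∫ z : Eu n, (1 + ‖z‖ ^ 2) ^ (-(((n : ℝ) + 1 + α) / 2)) *
      linePV p α β (ε / √(1 + ‖z‖ ^ 2)) := by
  set r : ℝ := ((n + 1 : ℕ) : ℝ) + α with hr
  have hrn : r = (n : ℝ) + 1 + α := by rw [hr]; push_cast; ring
  obtain ⟨Φ, hΦ, hΦ1, hΦ2⟩ := exists_slicing hν
  set H : ℝ × Eu n → ℝ := {q : ℝ × Eu n | ε < √(q.1 ^ 2 + ‖q.2‖ ^ 2)}.indicator fun q =>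
    Jp p (1 - posPow β (1 + q.1)) / √(q.1 ^ 2 + ‖q.2‖ ^ 2) ^ r with hH
  have hset : MeasurableSet {q : ℝ × Eu n | ε < √(q.1 ^ 2 + ‖q.2‖ ^ 2)} :=
    measurableSet_lt (by fun_prop) (by fun_prop)
  have hHm : Measurable H := Measurable.indicator (by fun_prop) hset
  have hset' : MeasurableSet {w : Eu (n + 1) | ε < ‖w‖} :=
    measurableSet_lt (by fun_prop) (by fun_prop)
  have hcomp : ∀ w, H (Φ w) = {w : Eu (n + 1) | ε < ‖w‖}.indicator
      (fun w => Jp p (1 - posPow β (1 + inner ℝ ν w)) / ‖w‖ ^ r) w := fun w => by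
    have hw : √((Φ w).1 ^ 2 + ‖(Φ w).2‖ ^ 2) = ‖w‖ := by
      rw [← hΦ2, Real.sqrt_sq (norm_nonneg _)]
    rw [hΦ1] at hw
    simp only [hH, indicator, mem_ofPred_eq, hΦ1, hw]
  have hHint : Integrable H := by
    rw [← hΦ.integrable_comp_emb Φ.measurableEmbedding]
    have hfar := integrableOn_far (N := n + 1) (r := r) hp (by linarith)
      (u := fun w => posPow β (1 + inner ℝ ν w)) (by fun_prop) ?_ 0 1 hε
    · simp only [zero_sub, norm_neg] at hfar
      exact ((integrable_indicator_iff hset').2 hfar).congr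
        (ae_of_all _ fun w => (hcomp w).symm)
    · refine (integrable_posPow_tail hν (-1) hα hβ hβ').congr (ae_of_all _ fun w => ?_)
      beta_reduce
      rw [abs_of_nonneg (posPow_nonneg _ _), posPow_rpow (by linarith), sub_neg_eq_add, add_comm]
  have hhalf : halfPV p α β ν ε = ∫ q, H q := by
    rw [← hΦ.integral_comp Φ.measurableEmbedding, halfPV, ← integral_indicator hset']
    exact integral_congr_ae (ae_of_all _ fun w => (hcomp w).symm)
  obtain ⟨hi, he⟩ := integral_prod_scale hHm hHint
  set H2 : ℝ × Eu n → ℝ := fun q => |q.1| ^ n * H (q.1, |q.1| • q.2) with hH2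
  have hH2eq : ∀ z : Eu n, ∫ τ, H2 (τ, z) = (1 + ‖z‖ ^ 2) ^ (-(((n : ℝ) + 1 + α) / 2)) *
      linePV p α β (ε / √(1 + ‖z‖ ^ 2)) := fun z => by
    have hz : 0 < 1 + ‖z‖ ^ 2 := by positivity
    have hs : 0 < √(1 + ‖z‖ ^ 2) := Real.sqrt_pos.2 hz
    rw [linePV, ← integral_const_mul, ← integral_indicator
      (measurableSet_lt measurable_const (by fun_prop))]
    refine integral_congr_ae ?_
    filter_upwards [Measure.ae_ne volume (0 : ℝ)] with τ hτ
    have hτ : 0 < |τ| := abs_pos.2 hτ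
    have hsq : √(τ ^ 2 + ‖|τ| • z‖ ^ 2) = |τ| * √(1 + ‖z‖ ^ 2) := by
      rw [norm_smul, Real.norm_eq_abs, abs_abs, mul_pow, sq_abs, ← mul_one_add,
        Real.sqrt_mul (sq_nonneg _), Real.sqrt_sq_eq_abs]
    simp only [hH2, hH, indicator, mem_ofPred_eq, hsq, div_lt_iff₀ hs]
    split_ifs
    · rw [Real.mul_rpow hτ.le hs.le, Real.sqrt_eq_rpow, ← Real.rpow_mul hz.le, Real.rpow_neg hz.le,
        show 1 / 2 * r = ((n : ℝ) + 1 + α) / 2 by rw [hrn]; ring,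
        show r = (n : ℝ) + (1 + α) by rw [hrn]; ring, Real.rpow_add hτ, Real.rpow_natCast]
      field_simp
    · rw [mul_zero]
  have hi' := hi
  rw [Measure.volume_eq_prod] at hi'
  refine ⟨hi'.integral_prod_right.congr (ae_of_all _ hH2eq), ?_⟩
  rw [hhalf, ← he, Measure.volume_eq_prod, integral_prod_symm _ hi']
  exact integral_congr_ae (ae_of_all _ hH2eq)

lemma integrable_slice_weight (n : ℕ) {α : ℝ} (hα : 0 < α) :
    Integrable fun z : Eu n => (1 + ‖z‖ ^ 2) ^ (-(((n : ℝ) + 1 + α) / 2)) := by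
  have h := integrable_rpow_neg_one_add_norm_sq (E := Eu n) (μ := volume) (r := (n : ℝ) + 1 + α)
    (by rw [finrank_euclideanSpace, Fintype.card_fin]; linarith)
  simpa only [neg_div] using h

lemma lamConst_eq (s p β : ℝ) :
    lamConst s p β = 2 * ((∫ t in Ioo (0 : ℝ) 1,
      kern p (s * p) β t * (1 - t ^ (s * p - 1 - β * (p - 1)))) + 1 / (s * p)) := by
  rw [lamConst, mul_add, mul_one_div]
  rfl

/-- Dominated convergence in z, using the bound on `linePV` uniform in the cutoff. The factor 1/2 is
later cancelled by the two symmetric halves of the energy. -/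
lemma tendsto_halfPV {N : ℕ} {s p β : ℝ} (hp : 1 < p) (hs0 : 0 < s) (hs1 : s < 1)
    (hβ : -1 < β * (p - 1)) (hβ' : β * (p - 1) < s * p) {ν : Eu N} (hν : ‖ν‖ = 1) :
    Tendsto (halfPV p (s * p) β ν) (𝓝[>] 0) (𝓝 (CN N (s * p) * lamConst s p β / 2)) := by
  obtain _ | n := N
  · rw [Subsingleton.elim ν 0, norm_zero] at hν
    exact absurd hν zero_ne_one
  have hα : 0 < s * p := by positivity
  have hαp : s * p < p := by nlinarith
  obtain ⟨B, hB0, hB⟩ := exists_linePV_bound hp hα hαp hβ hβ'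
  have hlim := tendsto_linePV hp hα hαp hβ hβ'
  have hCN : CN (n + 1) (s * p) * lamConst s p β / 2 =
      ∫ z : Eu n, (1 + ‖z‖ ^ 2) ^ (-(((n : ℝ) + 1 + s * p) / 2)) * (lamConst s p β / 2) := by
    rw [integral_mul_const, CN_eq_integral]; ring
  rw [hCN]
  have hev : ∀ᶠ ε in 𝓝[>] (0 : ℝ), (∫ z : Eu n, (1 + ‖z‖ ^ 2) ^ (-(((n : ℝ) + 1 + s * p) / 2)) *
      linePV p (s * p) β (ε / √(1 + ‖z‖ ^ 2))) = halfPV p (s * p) β ν ε := by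
    filter_upwards [self_mem_nhdsWithin] with ε hε
    exact (halfPV_eq_slices hp hα hβ hβ' hν hε).2.symm
  refine Tendsto.congr' hev ?_
  refine tendsto_integral_filter_of_dominated_convergence
    (fun z : Eu n => (1 + ‖z‖ ^ 2) ^ (-(((n : ℝ) + 1 + s * p) / 2)) * B) ?_ ?_
    ((integrable_slice_weight n hα).mul_const B) ?_
  · filter_upwards [self_mem_nhdsWithin] with ε hε
    exact (halfPV_eq_slices hp hα hβ hβ' hν hε).1.aestronglyMeasurable
  · filter_upwards [self_mem_nhdsWithin] with ε hε
    refine ae_of_all _ fun z => ?_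
    have hz : 0 < 1 + ‖z‖ ^ 2 := by positivity
    rw [norm_mul, Real.norm_eq_abs, Real.norm_eq_abs, abs_of_nonneg (by positivity)]
    exact mul_le_mul_of_nonneg_left (hB _ (div_pos hε (Real.sqrt_pos.2 hz))) (by positivity)
  · refine ae_of_all _ fun z => Tendsto.const_mul _ ?_
    have hs : 0 < √(1 + ‖z‖ ^ 2) := Real.sqrt_pos.2 (by positivity)
    rw [lamConst_eq, mul_div_cancel_left₀ _ two_ne_zero]
    refine hlim.comp (tendsto_nhdsWithin_iff.2 ⟨?_, ?_⟩)
    · have : Tendsto (fun ε : ℝ => ε / √(1 + ‖z‖ ^ 2)) (𝓝 0) (𝓝 (0 / √(1 + ‖z‖ ^ 2))) :=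
        tendsto_id.div_const _
      rw [zero_div] at this
      exact this.mono_left nhdsWithin_le_nhds
    · filter_upwards [self_mem_nhdsWithin] with ε hε
      exact div_pos hε hs

lemma exists_halfPV_bound {N : ℕ} {s p β : ℝ} (hp : 1 < p) (hs0 : 0 < s) (hs1 : s < 1)
    (hβ : -1 < β * (p - 1)) (hβ' : β * (p - 1) < s * p) :
    ∃ B, 0 ≤ B ∧ ∀ ν : Eu N, ‖ν‖ = 1 → ∀ ε, 0 < ε → |halfPV p (s * p) β ν ε| ≤ B := by
  obtain _ | n := N
  · refine ⟨0, le_rfl, fun ν hν => ?_⟩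
    rw [Subsingleton.elim ν 0, norm_zero] at hν
    exact absurd hν zero_ne_one
  have hα : 0 < s * p := by positivity
  have hαp : s * p < p := by nlinarith
  obtain ⟨B, hB0, hB⟩ := exists_linePV_bound hp hα hαp hβ hβ'
  refine ⟨∫ z : Eu n, (1 + ‖z‖ ^ 2) ^ (-(((n : ℝ) + 1 + s * p) / 2)) * B,
    integral_nonneg fun z => by positivity, fun ν hν ε hε => ?_⟩
  rw [(halfPV_eq_slices hp hα hβ hβ' hν hε).2, ← Real.norm_eq_abs]
  refine norm_integral_le_of_norm_le ((integrable_slice_weight n hα).mul_const B)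
    (ae_of_all _ fun z => ?_)
  have hz : 0 < 1 + ‖z‖ ^ 2 := by positivity
  rw [norm_mul, Real.norm_eq_abs, Real.norm_eq_abs, abs_of_nonneg (by positivity)]
  exact mul_le_mul_of_nonneg_left (hB _ (div_pos hε (Real.sqrt_pos.2 hz))) (by positivity)

/-- The truncated principal value of the fractional `p`-Laplacian, up to a factor two. -/
def truncPV {N : ℕ} (p r ε : ℝ) (u : Eu N → ℝ) (x : Eu N) : ℝ :=
  ∫ y in {y : Eu N | ε < ‖x - y‖}, Jp p (u x - u y) / ‖x - y‖ ^ r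

/-- Translating x to the origin and dilating by its distance d to the hyperplane normalises the
profile to distance one; the prefactor is its homogeneity. -/
lemma truncPV_halfSpace {N : ℕ} {p α β : ℝ} {ν : Eu N} {c ε : ℝ} {x : Eu N}
    (hx : c < inner ℝ ν x) :
    truncPV p ((N : ℝ) + α) ε (fun y => posPow β (inner ℝ ν y - c)) x =
      (inner ℝ ν x - c) ^ (β * (p - 1) - α) * halfPV p α β ν (ε / (inner ℝ ν x - c)) := by
  set d := inner ℝ ν x - c with hd
  have hd0 : 0 < d := sub_pos.2 hx
  rw [truncPV, halfPV, ← integral_indicator (measurableSet_far x ε),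
    ← integral_indicator (measurableSet_lt measurable_const (by fun_prop)),
    ← integral_add_left_eq_self _ x]
  set F : Eu N → ℝ := fun y => {y | ε < ‖x - y‖}.indicator
    (fun y => Jp p (posPow β d - posPow β (inner ℝ ν y - c)) / ‖x - y‖ ^ ((N : ℝ) + α)) (x + y)
    with hF
  have h := Measure.integral_comp_smul volume F d
  rw [finrank_euclideanSpace, Fintype.card_fin, abs_of_pos (by positivity), smul_eq_mul,
    eq_inv_mul_iff_mul_eq₀ (by positivity)] at h
  rw [← h, ← integral_const_mul, ← integral_const_mul]
  refine integral_congr_ae (ae_of_all _ fun w => ?_)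
  have hn : ‖x - (x + d • w)‖ = d * ‖w‖ := by
    rw [sub_add_cancel_left, norm_neg, norm_smul, Real.norm_eq_abs, abs_of_pos hd0]
  have hin : inner ℝ ν (x + d • w) - c = d * (1 + inner ℝ ν w) := by
    rw [inner_add_right, inner_smul_right, hd]; ring
  simp only [hF, indicator, mem_ofPred_eq, hn, hin, div_lt_iff₀' hd0]
  split_ifs
  · rw [posPow_mul hd0, posPow_of_pos hd0, ← mul_one_sub, Jp_mul p (by positivity),
      Real.mul_rpow hd0.le (norm_nonneg _), Real.rpow_add hd0, Real.rpow_natCast,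
      Real.rpow_sub hd0, ← Real.rpow_mul hd0.le]
    field_simp
  · rw [mul_zero, mul_zero]

/-! ### The energy as a limit of truncated operators -/

section

variable {N : ℕ} {s p : ℝ} {Ω : Set (Eu N)} {u φ : Eu N → ℝ}

lemma IsTest.aestronglyMeasurable (h : IsTest s p Ω φ) : AEStronglyMeasurable φ volume := by
  have := h.1.1.1
  rwa [Measure.restrict_univ] at this

lemma IsTest.integrable (hp : 1 < p) (h : IsTest s p Ω φ) : Integrable φ := by
  have hK : IsCompact (tsupport φ) := h.2.2.1
  have h1 := h.1.1
  rw [Measure.restrict_univ] at h1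
  have : IsFiniteMeasure (volume.restrict (tsupport φ)) :=
    ⟨by rw [Measure.restrict_apply_univ]; exact hK.measure_lt_top⟩
  have h2 : IntegrableOn φ (tsupport φ) := (h1.restrict (tsupport φ)).integrable (by
    rw [← ENNReal.ofReal_one]; exact ENNReal.ofReal_le_ofReal hp.le)
  exact (integrableOn_iff_integrable_of_support_subset (subset_tsupport φ)).1 h2

/-- The set of pairs at distance more than `ε`. -/
def farPairs (N : ℕ) (ε : ℝ) : Set (Eu N × Eu N) := {z | ε < ‖z.1 - z.2‖}

lemma measurableSet_farPairs (N : ℕ) (ε : ℝ) : MeasurableSet (farPairs N ε) :=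
  measurableSet_lt measurable_const (by fun_prop)

lemma aestronglyMeasurable_energyIntegrand (hu : Measurable u)
    (hφ : AEStronglyMeasurable φ volume) :
    AEStronglyMeasurable (energyIntegrand s p u φ) := by
  have h1 : AEStronglyMeasurable (fun z : Eu N × Eu N => φ z.1 - φ z.2) volume :=
    hφ.comp_fst.sub hφ.comp_snd
  have h2 : Measurable fun z : Eu N × Eu N => Jp p (u z.1 - u z.2) := by fun_prop
  have h3 : Measurable fun z : Eu N × Eu N => (‖z.1 - z.2‖ ^ ((N : ℝ) + s * p))⁻¹ := by fun_prop
  refine ((h2.aestronglyMeasurable.mul h1).mul h3.aestronglyMeasurable).congr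
    (ae_of_all _ fun z => ?_)
  simp only [energyIntegrand, div_eq_mul_inv, Pi.mul_apply]

lemma integrableOn_of_gagliardo_lt_top {E : Set (Eu N)} (hu : AEStronglyMeasurable u volume)
    (h : gagliardo s p E u < ⊤) :
    IntegrableOn (fun z : Eu N × Eu N => |u z.1 - u z.2| ^ p / ‖z.1 - z.2‖ ^ ((N : ℝ) + s * p))
      (E ×ˢ E) := by
  have h1 : AEStronglyMeasurable (fun z : Eu N × Eu N => u z.1 - u z.2) volume :=
    hu.comp_fst.sub hu.comp_snd
  have h3 : Measurable fun z : Eu N × Eu N => (‖z.1 - z.2‖ ^ ((N : ℝ) + s * p))⁻¹ := by fun_prop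
  have hm : AEStronglyMeasurable
      (fun z : Eu N × Eu N => |u z.1 - u z.2| ^ p / ‖z.1 - z.2‖ ^ ((N : ℝ) + s * p)) volume := by
    simp only [div_eq_mul_inv]
    exact ((h1.aemeasurable.abs.pow_const p).mul h3.aemeasurable).aestronglyMeasurable
  refine ⟨hm.restrict, ?_⟩
  rw [hasFiniteIntegral_iff_ofReal (ae_of_all _ fun z => by positivity)]
  exact h

lemma rpow_sub_one_mul_le (hp : 1 < p) {a b : ℝ} (ha : 0 ≤ a) (hb : 0 ≤ b) :
    a ^ (p - 1) * b ≤ a ^ p + b ^ p := by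
  have key : ∀ {c : ℝ}, 0 ≤ c → c ^ (p - 1) * c = c ^ p := fun {c} hc => by
    rw [← Real.rpow_add_one' hc (by linarith), sub_add_cancel]
  have hp1 : 0 ≤ p - 1 := by linarith
  rcases le_total a b with h | h
  · calc a ^ (p - 1) * b ≤ b ^ (p - 1) * b := by gcongr
      _ ≤ a ^ p + b ^ p := by rw [key hb]; linarith [Real.rpow_nonneg ha p]
  · calc a ^ (p - 1) * b ≤ a ^ (p - 1) * a := by gcongr
      _ ≤ a ^ p + b ^ p := by rw [key ha]; linarith [Real.rpow_nonneg hb p]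

lemma integrableOn_energy_near (hp : 1 < p) (hu : Measurable u) {E : Set (Eu N)}
    (hW : gagliardo s p E u < ⊤) (hφ : IsTest s p Ω φ) :
    IntegrableOn (energyIntegrand s p u φ) (E ×ˢ E) := by
  have h1 := integrableOn_of_gagliardo_lt_top hu.aestronglyMeasurable hW
  have h2 := (integrableOn_of_gagliardo_lt_top hφ.aestronglyMeasurable hφ.1.2).mono_set
    (show E ×ˢ E ⊆ univ ×ˢ univ from prod_mono (subset_univ _) (subset_univ _))
  refine (h1.add h2).mono' (aestronglyMeasurable_energyIntegrand hu
    hφ.aestronglyMeasurable).restrict (ae_of_all _ fun z => ?_)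
  rw [Pi.add_apply, energyIntegrand, norm_div, norm_mul, Real.norm_eq_abs, Real.norm_eq_abs,
    abs_Jp hp, ← add_div, Real.norm_eq_abs, abs_of_nonneg (a := ‖z.1 - z.2‖ ^ _) (by positivity)]
  gcongr
  exact rpow_sub_one_mul_le hp (abs_nonneg _) (abs_nonneg _)

/-- The part of the energy integrand carrying `φ(x)`, restricted to far pairs. -/
def farEnergy (p r ε : ℝ) (u ψ : Eu N → ℝ) : Eu N × Eu N → ℝ :=
  (farPairs N ε).indicator fun z => ψ z.1 * (Jp p (u z.1 - u z.2) / ‖z.1 - z.2‖ ^ r)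

/-- Since u and x are bounded where ψ ≠ 0, the kernel bound separates: |ψ(x)| times an integrable
function of y. -/
lemma integrable_farEnergy {r : ℝ} (hp : 1 < p) (hr : (N : ℝ) < r) (hu : Measurable u)
    (htail : Integrable fun y : Eu N => |u y| ^ (p - 1) / (1 + ‖y‖) ^ r) {ψ : Eu N → ℝ}
    (hψ : Integrable ψ) {R M : ℝ} (hψR : ∀ x, ψ x ≠ 0 → ‖x‖ ≤ R ∧ |u x| ≤ M) {ε : ℝ}
    (hε : 0 < ε) : Integrable (farEnergy p r ε u ψ) := by
  have hr0 : 0 ≤ r := (Nat.cast_nonneg N).trans hr.le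
  have hmeas : AEStronglyMeasurable (farEnergy p r ε u ψ) volume := by
    have h2 : Measurable fun z : Eu N × Eu N =>
      Jp p (u z.1 - u z.2) / ‖z.1 - z.2‖ ^ r := by fun_prop
    exact (hψ.aestronglyMeasurable.comp_fst.mul h2.aestronglyMeasurable).indicator
      (measurableSet_farPairs N ε)
  have hdom := hψ.norm.mul_prod ((((integrable_inv_one_add_norm_rpow hr).const_mul
    (M ^ (p - 1))).add htail).const_mul (2 ^ (p - 1) * ((1 + R) / ε + 1) ^ r))
  refine hdom.mono' hmeas (ae_of_all _ fun z => ?_)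
  by_cases hz : ψ z.1 = 0
  · simp [farEnergy, indicator, hz]
  obtain ⟨hR, hM⟩ := hψR _ hz
  have hR0 : 0 ≤ R := (norm_nonneg _).trans hR
  have hM0 : 0 ≤ M := (abs_nonneg _).trans hM
  by_cases hf : z ∈ farPairs N ε
  · rw [farEnergy, indicator_of_mem hf, norm_mul, Pi.add_apply]
    refine mul_le_mul_of_nonneg_left ?_ (norm_nonneg _)
    refine (abs_far_le hp hr0 hε hR hf _ _).trans ?_
    have : 0 ≤ p - 1 := by linarith
    gcongr
  · rw [farEnergy, indicator_of_notMem hf, norm_zero, Pi.add_apply]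
    positivity

/-- Local boundedness on compact subsets. -/
def LocBdd (Ω : Set (Eu N)) (u : Eu N → ℝ) : Prop :=
  ∀ K ⊆ Ω, IsCompact K → ∃ M, ∀ x ∈ K, |u x| ≤ M

lemma IsTest.exists_bounds (hb : LocBdd Ω u) (hφ : IsTest s p Ω φ) :
    ∃ R M, ∀ x, φ x ≠ 0 → ‖x‖ ≤ R ∧ |u x| ≤ M := by
  obtain ⟨R, hR⟩ := hφ.2.2.1.isBounded.exists_norm_le
  obtain ⟨M, hM⟩ := hb _ hφ.2.2.2 hφ.2.2.1
  exact ⟨R, M, fun x hx => ⟨hR x (subset_tsupport φ hx), hM x (subset_tsupport φ hx)⟩⟩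

/-- Oddness of J_p makes the φ(y) half the swap of the φ(x) half. Away from the diagonal both halves
are integrable separately, which the full integrand need not allow. -/
lemma indicator_energy_eq (ε : ℝ) (z : Eu N × Eu N) :
    (farPairs N ε).indicator (energyIntegrand s p u φ) z =
      farEnergy p ((N : ℝ) + s * p) ε u φ z + farEnergy p ((N : ℝ) + s * p) ε u φ z.swap := by
  have hsw : z.swap ∈ farPairs N ε ↔ z ∈ farPairs N ε := by
    simp [farPairs, norm_sub_rev]
  by_cases hz : z ∈ farPairs N ε
  · rw [farEnergy, indicator_of_mem hz, indicator_of_mem hz, indicator_of_mem (hsw.2 hz)]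
    simp only [energyIntegrand, Prod.fst_swap, Prod.snd_swap]
    rw [norm_sub_rev z.2, ← neg_sub (u z.1) (u z.2), Jp_neg]
    ring
  · rw [farEnergy, indicator_of_notMem hz, indicator_of_notMem hz,
      indicator_of_notMem fun h => hz (hsw.1 h), add_zero]

/-- If both points lie in a compactly contained neighbourhood of the support of φ, the Gagliardo
seminorms of u and φ suffice. Otherwise either the pair is separated by a fixed distance and the
tail bound applies, or φ vanishes at both points. -/
lemma integrable_energyIntegrand (hp : 1 < p) (hs0 : 0 < s) (hΩo : IsOpen Ω)
    (hu : Measurable u) (hW : MemWloc s p Ω u)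
    (htail : Integrable fun y : Eu N => |u y| ^ (p - 1) / (1 + ‖y‖) ^ ((N : ℝ) + s * p))
    (hb : LocBdd Ω u) (hφ : IsTest s p Ω φ) : Integrable (energyIntegrand s p u φ) := by
  have hsp : 0 < s * p := by positivity
  obtain ⟨R, M, hRM⟩ := hφ.exists_bounds hb
  obtain ⟨δ, hδ, hsub⟩ := hφ.2.2.1.exists_cthickening_subset_open hΩo hφ.2.2.2
  set E := Metric.thickening δ (tsupport φ) with hE
  have hcl : closure E ⊆ Metric.cthickening δ (tsupport φ) :=
    Metric.closure_thickening_subset_cthickening _ _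
  have hEc : IsCompact (closure E) :=
    (hφ.2.2.1.cthickening).of_isClosed_subset isClosed_closure hcl
  have hEo : IsOpen E := Metric.isOpen_thickening
  have h1 := integrableOn_energy_near hp hu
    (hW E hEo hEc (hcl.trans hsub)).2 hφ
  rw [← integrable_indicator_iff (hEo.measurableSet.prod hEo.measurableSet)] at h1
  have h2 := integrable_farEnergy hp (show (N : ℝ) < (N : ℝ) + s * p by linarith) hu htail
    (hφ.integrable hp) hRM (half_pos hδ)
  have h3 : Integrable fun z : Eu N × Eu N =>
    farEnergy p ((N : ℝ) + s * p) (δ / 2) u φ z.swap := h2.swap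
  refine ((h1.norm.add (h2.add h3).norm)).mono' (aestronglyMeasurable_energyIntegrand hu
    hφ.aestronglyMeasurable) (ae_of_all _ fun z => ?_)
  have h0 : ∀ x, x ∉ E → φ x = 0 := fun x hx => by
    by_contra h
    exact hx (Metric.self_subset_thickening hδ _ (subset_tsupport φ h))
  have hdist : ∀ x y, x ∈ tsupport φ → y ∉ E → δ / 2 < ‖x - y‖ := fun x y hx hy => by
    by_contra! h
    refine hy (Metric.mem_thickening_iff.2 ⟨x, hx, ?_⟩)
    rw [dist_comm, dist_eq_norm]
    linarith
  rw [Pi.add_apply]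
  by_cases hz : z ∈ E ×ˢ E
  · refine le_add_of_le_of_nonneg ?_ (norm_nonneg _)
    rw [indicator_of_mem hz]
  · by_cases hf : z ∈ farPairs N (δ / 2)
    · refine le_add_of_nonneg_of_le (norm_nonneg _) ?_
      rw [Pi.add_apply, ← indicator_energy_eq, indicator_of_mem hf]
    · have hen : energyIntegrand s p u φ z = 0 := by
        have h1 : φ z.1 = 0 := by
          by_contra hne
          have hz1 := subset_tsupport φ hne
          by_cases hz2 : z.2 ∈ E
          · exact hz ⟨Metric.self_subset_thickening hδ _ hz1, hz2⟩
          · exact hf (hdist _ _ hz1 hz2)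
        have h2 : φ z.2 = 0 := by
          by_contra hne
          have hz2 := subset_tsupport φ hne
          by_cases hz1 : z.1 ∈ E
          · exact hz ⟨hz1, Metric.self_subset_thickening hδ _ hz2⟩
          · refine hf ?_
            have := hdist _ _ hz2 hz1
            rwa [norm_sub_rev] at this
        rw [energyIntegrand, h1, h2]
        simp
      rw [hen, norm_zero]
      positivity

lemma integral_far_energy (hp : 1 < p) (hs0 : 0 < s) (hu : Measurable u)
    (htail : Integrable fun y : Eu N => |u y| ^ (p - 1) / (1 + ‖y‖) ^ ((N : ℝ) + s * p))
    (hb : LocBdd Ω u) (hφ : IsTest s p Ω φ) {ε : ℝ} (hε : 0 < ε) :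
    Integrable (fun x => φ x * truncPV p ((N : ℝ) + s * p) ε u x) ∧
    ∫ z in farPairs N ε, energyIntegrand s p u φ z =
      2 * ∫ x, φ x * truncPV p ((N : ℝ) + s * p) ε u x := by
  have hsp : 0 < s * p := by positivity
  obtain ⟨R, M, hRM⟩ := hφ.exists_bounds hb
  have h2 := integrable_farEnergy hp (show (N : ℝ) < (N : ℝ) + s * p by linarith) hu htail
    (hφ.integrable hp) hRM hε
  have h3 : Integrable fun z : Eu N × Eu N =>
    farEnergy p ((N : ℝ) + s * p) ε u φ z.swap := h2.swap
  have hin : ∀ x, ∫ y, farEnergy p ((N : ℝ) + s * p) ε u φ (x, y) =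
      φ x * truncPV p ((N : ℝ) + s * p) ε u x := fun x => by
    rw [truncPV, ← integral_const_mul, ← integral_indicator (measurableSet_far x ε)]
    rfl
  rw [Measure.volume_eq_prod] at h2 h3
  refine ⟨h2.integral_prod_left.congr (ae_of_all _ hin), ?_⟩
  rw [← integral_indicator (measurableSet_farPairs N ε),
    integral_congr_ae (ae_of_all _ (indicator_energy_eq ε)), Measure.volume_eq_prod,
    integral_add h2 h3, integral_prod_swap, ← two_mul, integral_prod _ h2]
  congr 1
  exact integral_congr_ae (ae_of_all _ hin)

lemma tendsto_truncated_energy (hp : 1 < p) (hs0 : 0 < s) (hΩo : IsOpen Ω)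
    (hu : Measurable u) (hW : MemWloc s p Ω u)
    (htail : Integrable fun y : Eu N => |u y| ^ (p - 1) / (1 + ‖y‖) ^ ((N : ℝ) + s * p))
    (hb : LocBdd Ω u) (hφ : IsTest s p Ω φ) :
    Tendsto (fun ε => 2 * ∫ x, φ x * truncPV p ((N : ℝ) + s * p) ε u x) (𝓝[>] 0)
      (𝓝 (∫ z, energyIntegrand s p u φ z)) := by
  have hint := integrable_energyIntegrand hp hs0 hΩo hu hW htail hb hφ
  have hev : ∀ᶠ ε in 𝓝[>] (0 : ℝ), ∫ z, (farPairs N ε).indicator (energyIntegrand s p u φ) z =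
      2 * ∫ x, φ x * truncPV p ((N : ℝ) + s * p) ε u x := by
    filter_upwards [self_mem_nhdsWithin] with ε hε
    rw [integral_indicator (measurableSet_farPairs N ε),
      (integral_far_energy hp hs0 hu htail hb hφ hε).2]
  refine Tendsto.congr' hev ?_
  refine tendsto_integral_filter_of_dominated_convergence _ ?_ ?_ hint.norm ?_
  · exact Eventually.of_forall fun ε =>
      hint.aestronglyMeasurable.indicator (measurableSet_farPairs N ε)
  · exact Eventually.of_forall fun ε => ae_of_all _ fun z => norm_indicator_le_norm_self _ _
  · refine ae_of_all _ fun z => tendsto_const_nhds.congr' ?_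
    -- Diagonal pairs never enter the truncation, but the integrand is zero there.
    rcases eq_or_ne z.1 z.2 with h | h
    · refine Eventually.of_forall fun ε => ?_
      have h0 : energyIntegrand s p u φ z = 0 := by simp [energyIntegrand, h]
      rw [h0, eq_comm, indicator_apply_eq_zero]
      exact fun _ => h0
    · filter_upwards [Ioo_mem_nhdsGT (norm_pos_iff.2 (sub_ne_zero.2 h))] with ε hε
      rw [indicator_of_mem]
      exact hε.2

end

/-! ### Regularity of distance powers -/

section

variable {N : ℕ} {s p β : ℝ} {Ω : Set (Eu N)} {φ : Eu N → ℝ}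

lemma exists_bdist_bounds (hΩo : IsOpen Ω) (hΩ : Ω ≠ univ) {K : Set (Eu N)} (hK : IsCompact K)
    (hKΩ : K ⊆ Ω) : ∃ m M, 0 < m ∧ ∀ x ∈ K, bdist Ω x ∈ Icc m M := by
  rcases K.eq_empty_or_nonempty with rfl | hne
  · exact ⟨1, 1, one_pos, fun x hx => absurd hx (notMem_empty x)⟩
  have hc : ContinuousOn (bdist Ω) K := (Metric.continuous_infDist_pt _).continuousOn
  obtain ⟨a, ha, hmin⟩ := hK.exists_isMinOn hne hc
  obtain ⟨b, hb, hmax⟩ := hK.exists_isMaxOn hne hc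
  exact ⟨bdist Ω a, bdist Ω b, bdist_pos hΩo hΩ (hKΩ ha), fun x hx => ⟨hmin hx, hmax hx⟩⟩

lemma distPow_of_mem {x : Eu N} (hx : x ∈ Ω) (β : ℝ) : distPow Ω β x = bdist Ω x ^ β :=
  indicator_of_mem hx _

lemma exists_bdist_rpow_bound (hΩo : IsOpen Ω) (hΩ : Ω ≠ univ) (q : ℝ) {K : Set (Eu N)}
    (hK : IsCompact K) (hKΩ : K ⊆ Ω) : ∃ C, 0 ≤ C ∧ ∀ x ∈ K, bdist Ω x ^ q ≤ C := by
  obtain ⟨m, M, hm, hmM⟩ := exists_bdist_bounds hΩo hΩ hK hKΩ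
  obtain ⟨C, hC0, hC⟩ := exists_rpow_bound q M hm
  exact ⟨C, hC0, fun x hx => hC _ (hmM x hx)⟩

lemma locBdd_distPow (hΩo : IsOpen Ω) (hΩ : Ω ≠ univ) (β : ℝ) : LocBdd Ω (distPow Ω β) := by
  intro K hKΩ hK
  obtain ⟨C, -, hC⟩ := exists_bdist_rpow_bound hΩo hΩ β hK hKΩ
  refine ⟨C, fun x hx => ?_⟩
  rw [abs_of_nonneg (distPow_nonneg _ _ _), distPow_of_mem (hKΩ hx)]
  exact hC x hx

lemma integrableOn_rpow_norm_ball [Nontrivial (Eu N)] {q : ℝ} (hq : -(N : ℝ) < q) (D : ℝ) :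
    IntegrableOn (fun w : Eu N => ‖w‖ ^ q) (Metric.ball 0 D) := by
  rw [integrableOn_fun_norm_addHaar volume (f := fun t : ℝ => t ^ q)]
  rcases le_or_gt D 0 with hD | hD
  · rw [Ioo_eq_empty (not_lt.2 hD)]; exact integrableOn_empty
  have hN : 0 < Module.finrank ℝ (Eu N) := Module.finrank_pos
  have hN' : 0 < N := by simpa using hN
  have h := (intervalIntegral.integrableOn_Ioo_rpow_iff hD (s := (N : ℝ) - 1 + q)).2 (by linarith)
  refine h.congr_fun (fun t ht => ?_) measurableSet_Ioo
  have ht0 : 0 < t := ht.1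
  simp only [finrank_euclideanSpace, Fintype.card_fin, smul_eq_mul]
  rw [Real.rpow_add ht0, ← Nat.cast_pred hN', Real.rpow_natCast]

/-- Lipschitz functions on bounded open sets have finite Gagliardo seminorm. -/
lemma gagliardo_lt_top_of_lipschitz (hN : 1 ≤ N) (hp : 1 < p) (hs1 : s < 1)
    {E : Set (Eu N)} (hEb : Bornology.IsBounded E) {u : Eu N → ℝ} {L : ℝ}
    (hL0 : 0 ≤ L) (hL : ∀ x ∈ E, ∀ y ∈ E, |u x - u y| ≤ L * ‖x - y‖) :
    gagliardo s p E u < ⊤ := by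
  have : Nontrivial (Eu N) := by
    have : Nonempty (Fin N) := ⟨⟨0, hN⟩⟩
    infer_instance
  obtain ⟨R, hR⟩ := hEb.exists_norm_le
  set q := p - ((N : ℝ) + s * p) with hq
  -- A convolution kernel dominating the Gagliardo quotient; the ball contains all differences of
  -- points of E. It is integrable because q > -N, that is, s < 1.
  set k : Eu N → ℝ := (Metric.ball 0 (2 * R + 1)).indicator fun w => L ^ p * ‖w‖ ^ q with hk
  have hkint : Integrable k :=
    (integrable_indicator_iff Metric.isOpen_ball.measurableSet).2
      ((integrableOn_rpow_norm_ball (by nlinarith) _).const_mul _)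
  have hkm : Measurable k := Measurable.indicator (by fun_prop) Metric.isOpen_ball.measurableSet
  have hk0 : ∀ w, 0 ≤ k w := fun w => indicator_nonneg (fun w _ => by positivity) w
  have hle : gagliardo s p E u ≤ ∫⁻ z in E ×ˢ E, ENNReal.ofReal (k (z.1 - z.2)) := by
    refine setLIntegral_mono_ae (by fun_prop) (ae_of_all _ fun z hz => ENNReal.ofReal_le_ofReal ?_)
    rcases eq_or_ne z.1 z.2 with h | h
    · rw [h, sub_self, abs_zero, Real.zero_rpow (by linarith), zero_div]
      exact hk0 _
    · have hd : 0 < ‖z.1 - z.2‖ := norm_pos_iff.2 (sub_ne_zero.2 h)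
      have hm : z.1 - z.2 ∈ Metric.ball (0 : Eu N) (2 * R + 1) := by
        rw [mem_ball_zero_iff]
        linarith [norm_sub_le z.1 z.2, hR _ hz.1, hR _ hz.2]
      rw [hk, indicator_of_mem hm, hq, Real.rpow_sub hd, ← mul_div_assoc,
        ← Real.mul_rpow hL0 hd.le]
      have : 0 ≤ p := by linarith
      have := hL _ hz.1 _ hz.2
      gcongr
  refine hle.trans_lt ?_
  rw [Measure.volume_eq_prod, ← Measure.prod_restrict, lintegral_prod _ (by fun_prop)]
  calc ∫⁻ x in E, ∫⁻ y in E, ENNReal.ofReal (k (x - y))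
      ≤ ∫⁻ x in E, ∫⁻ w, ENNReal.ofReal (k w) := by
        refine lintegral_mono fun x => ?_
        exact (setLIntegral_le_lintegral _ _).trans
          (lintegral_sub_left_eq_self (fun w => ENNReal.ofReal (k w)) x).le
    _ = (∫⁻ w, ENNReal.ofReal (k w)) * volume E := by
        rw [setLIntegral_const]
    _ < ⊤ := by
        refine ENNReal.mul_lt_top ?_ hEb.measure_lt_top
        rw [← hasFiniteIntegral_iff_ofReal (ae_of_all _ hk0)]
        exact hkint.2

lemma memWloc_distPow (hN : 1 ≤ N) (hp : 1 < p) (hs1 : s < 1) (hΩo : IsOpen Ω) (hΩ : Ω ≠ univ)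
    (β : ℝ) : MemWloc s p Ω (distPow Ω β) := by
  intro E hEo hEc hEΩ
  have hEb : Bornology.IsBounded E := hEc.isBounded.subset subset_closure
  obtain ⟨m, M, hm, hmM⟩ := exists_bdist_bounds hΩo hΩ hEc hEΩ
  obtain ⟨L, hL0, hL⟩ := exists_rpow_lipschitz β M hm
  obtain ⟨C, hC⟩ := locBdd_distPow hΩo hΩ β _ hEΩ hEc
  constructor
  · have : IsFiniteMeasure (volume.restrict E) :=
      ⟨by rw [Measure.restrict_apply_univ]; exact hEb.measure_lt_top⟩
    refine MemLp.of_bound (measurable_distPow hΩo β).aestronglyMeasurable C ?_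
    exact (ae_restrict_iff' hEo.measurableSet).2 (ae_of_all _ fun x hx => hC x (subset_closure hx))
  · refine gagliardo_lt_top_of_lipschitz hN hp hs1 hEb hL0 fun x hx y hy => ?_
    have hx' := subset_closure hx
    have hy' := subset_closure hy
    rw [distPow_of_mem (hEΩ hx'), distPow_of_mem (hEΩ hy')]
    refine (hL _ (hmM x hx') _ (hmM y hy')).trans (mul_le_mul_of_nonneg_left ?_ hL0)
    rw [← dist_eq_norm, ← Real.dist_eq]
    simpa [bdist] using (Metric.lipschitz_infDist_pt (frontier Ω)).dist_le_mul x y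

lemma memTail_of_integrable {u : Eu N → ℝ} {q α : ℝ} (hq : 0 < q) (hNα : 0 ≤ (N : ℝ) + α)
    (hu : Measurable u)
    (h : Integrable fun x : Eu N => |u x| ^ q / (1 + ‖x‖) ^ ((N : ℝ) + α)) : MemTail q α u := by
  refine ⟨fun K hK => ?_, h⟩
  obtain ⟨R, hR⟩ := hK.isBounded.exists_norm_le
  rw [← integrable_norm_rpow_iff hu.aestronglyMeasurable (by simpa using hq) ENNReal.ofReal_ne_top,
    ENNReal.toReal_ofReal hq.le]
  refine (h.integrableOn.mul_const ((1 + R) ^ ((N : ℝ) + α))).mono'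
    (Measurable.aestronglyMeasurable (by fun_prop)) ?_
  refine (ae_restrict_iff' hK.measurableSet).2 (ae_of_all _ fun x hx => ?_)
  rw [Real.norm_eq_abs, Real.norm_eq_abs, abs_of_nonneg (by positivity), div_mul_eq_mul_div,
    le_div_iff₀ (by positivity)]
  refine mul_le_mul_of_nonneg_left ?_ (by positivity)
  exact Real.rpow_le_rpow (by positivity) (by linarith [hR x hx]) hNα

/-- A single dominating half-space profile controls the tail, whatever the shape of Ω. -/
lemma integrable_distPow_tail (hp : 1 < p) {α : ℝ} (hα : 0 < α) (hβ : -1 < β * (p - 1))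
    (hβ' : β * (p - 1) < α) (hΩo : IsOpen Ω) {ν : Eu N} (hν : ‖ν‖ = 1) {c : ℝ}
    (hle : ∀ y, distPow Ω β y ≤ posPow β (inner ℝ ν y - c)) :
    Integrable fun y : Eu N => |distPow Ω β y| ^ (p - 1) / (1 + ‖y‖) ^ ((N : ℝ) + α) := by
  obtain _ | n := N
  · rw [Subsingleton.elim ν 0, norm_zero] at hν
    exact absurd hν zero_ne_one
  have hm := measurable_distPow hΩo β
  refine (integrable_posPow_tail hν c hα hβ hβ').mono'
    (Measurable.aestronglyMeasurable (by fun_prop)) (ae_of_all _ fun y => ?_)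
  rw [Real.norm_eq_abs, abs_of_nonneg (by positivity), abs_of_nonneg (distPow_nonneg _ _ _),
    ← posPow_rpow (by linarith)]
  have h0 := distPow_nonneg Ω β y
  have h1 := hle y
  have h2 : 0 ≤ p - 1 := by linarith
  gcongr

lemma hardyIntegrand_distPow (hp : 1 < p) (hΩo : IsOpen Ω) (hΩ : Ω ≠ univ) {x : Eu N}
    (hx : x ∈ Ω) : hardyIntegrand s p Ω (distPow Ω β) φ x =
      bdist Ω x ^ (β * (p - 1) - s * p) * φ x := by
  have hd := bdist_pos hΩo hΩ hx
  rw [hardyIntegrand, Jp_of_nonneg hp (distPow_nonneg _ _ _), distPow_of_mem hx,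
    ← Real.rpow_mul hd.le, ← Real.rpow_sub hd]

lemma IsTest.eq_zero_of_notMem (hφ : IsTest s p Ω φ) {x : Eu N} (hx : x ∉ Ω) : φ x = 0 := by
  by_contra h
  exact hx (hφ.2.2.2 (subset_tsupport φ h))

lemma integrableOn_hardy (hp : 1 < p) (hΩo : IsOpen Ω) (hΩ : Ω ≠ univ) (hφ : IsTest s p Ω φ)
    (β : ℝ) : IntegrableOn (hardyIntegrand s p Ω (distPow Ω β) φ) Ω := by
  obtain ⟨C, hC0, hC⟩ := exists_bdist_rpow_bound hΩo hΩ (β * (p - 1) - s * p) hφ.2.2.1 hφ.2.2.2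
  have hbm : Measurable (bdist Ω) := (Metric.continuous_infDist_pt _).measurable
  have h : IntegrableOn (fun x => bdist Ω x ^ (β * (p - 1) - s * p) * φ x) Ω := by
    refine ((hφ.integrable hp).norm.const_mul C).integrableOn.mono'
      ((hbm.pow_const _).aestronglyMeasurable.mul hφ.aestronglyMeasurable).restrict
      (ae_of_all _ fun x => ?_)
    rw [norm_mul]
    by_cases hx : φ x = 0
    · simp [hx]
    · refine mul_le_mul_of_nonneg_right ?_ (norm_nonneg _)
      rw [Real.norm_eq_abs, abs_of_nonneg (a := bdist Ω x ^ _)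
        (Real.rpow_nonneg Metric.infDist_nonneg _)]
      exact hC x (subset_tsupport φ hx)
  exact h.congr_fun (fun x hx => (hardyIntegrand_distPow hp hΩo hΩ hx).symm) hΩo.measurableSet

/-! ### Comparison with half-spaces -/

lemma measurable_halfPV (p α β : ℝ) (ν : Eu N) : Measurable (halfPV p α β ν) := by
  have hset : MeasurableSet {z : ℝ × Eu N | z.1 < ‖z.2‖} :=
    measurableSet_lt (by fun_prop) (by fun_prop)
  have h : StronglyMeasurable ({z : ℝ × Eu N | z.1 < ‖z.2‖}.indicator fun z =>
      Jp p (1 - posPow β (1 + inner ℝ ν z.2)) / ‖z.2‖ ^ ((N : ℝ) + α)) :=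
    (Measurable.indicator (by fun_prop) hset).stronglyMeasurable
  have he : halfPV p α β ν = fun ε => ∫ w, {z : ℝ × Eu N | z.1 < ‖z.2‖}.indicator (fun z =>
      Jp p (1 - posPow β (1 + inner ℝ ν z.2)) / ‖z.2‖ ^ ((N : ℝ) + α)) (ε, w) := by
    funext ε
    rw [halfPV, ← integral_indicator (measurableSet_lt measurable_const (by fun_prop))]
    rfl
  rw [he]
  exact h.integral_prod_right'.measurable

/-- The supporting direction varies with x. Independence of the direction allows one fixed ν in the
comparison function, so no measurable choice of supporting half-spaces is needed. -/
lemma halfPV_congr {α : ℝ} (hp : 1 < p) (hα : 0 < α) (hβ : -1 < β * (p - 1))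
    (hβ' : β * (p - 1) < α) {ν ν' : Eu N} (hν : ‖ν‖ = 1) (hν' : ‖ν'‖ = 1) {ε : ℝ} (hε : 0 < ε) :
    halfPV p α β ν ε = halfPV p α β ν' ε := by
  obtain _ | n := N
  · rw [Subsingleton.elim ν ν']
  rw [(halfPV_eq_slices hp hα hβ hβ' hν hε).2, (halfPV_eq_slices hp hα hβ hβ' hν' hε).2]

/-- The half-space comparison function for the truncated operator tested against `φ`. -/
def halfSpaceTest (s p β : ℝ) (Ω : Set (Eu N)) (φ : Eu N → ℝ) (ν : Eu N) (ε : ℝ) (x : Eu N) : ℝ :=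
  hardyIntegrand s p Ω (distPow Ω β) φ x * halfPV p (s * p) β ν (ε / bdist Ω x)

/-- `halfPV` is bounded uniformly in its cutoff ε/d(x), so a multiple of the Hardy integrand
dominates. -/
lemma tendsto_integral_compare (hp : 1 < p) (hs0 : 0 < s) (hs1 : s < 1)
    (hβ : -1 < β * (p - 1)) (hβ' : β * (p - 1) < s * p) (hΩo : IsOpen Ω) (hΩ : Ω ≠ univ)
    (hφ : IsTest s p Ω φ) {ν : Eu N} (hν : ‖ν‖ = 1) :
    (∀ ε, 0 < ε → IntegrableOn (halfSpaceTest s p β Ω φ ν ε) Ω) ∧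
    Tendsto (fun ε => 2 * ∫ x in Ω, halfSpaceTest s p β Ω φ ν ε x) (𝓝[>] 0)
      (𝓝 (CN N (s * p) * lamConst s p β *
        ∫ x in Ω, hardyIntegrand s p Ω (distPow Ω β) φ x)) := by
  have hint := integrableOn_hardy hp hΩo hΩ hφ β
  obtain ⟨B, hB0, hB⟩ := exists_halfPV_bound (N := N) hp hs0 hs1 hβ hβ'
  have hbm : Measurable (bdist Ω) := (Metric.continuous_infDist_pt _).measurable
  have hm : ∀ ε, AEStronglyMeasurable (halfSpaceTest s p β Ω φ ν ε) (volume.restrict Ω) := fun ε =>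
    hint.aestronglyMeasurable.mul
      ((measurable_halfPV p (s * p) β ν).comp (hbm.const_div ε)).aestronglyMeasurable
  have hbound : ∀ ε, 0 < ε → ∀ᵐ x ∂(volume.restrict Ω), ‖halfSpaceTest s p β Ω φ ν ε x‖ ≤
      ‖hardyIntegrand s p Ω (distPow Ω β) φ x‖ * B := fun ε hε => by
    refine (ae_restrict_iff' hΩo.measurableSet).2 (ae_of_all _ fun x hx => ?_)
    rw [halfSpaceTest, norm_mul]
    exact mul_le_mul_of_nonneg_left (hB ν hν _ (div_pos hε (bdist_pos hΩo hΩ hx))) (norm_nonneg _)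
  refine ⟨fun ε hε => (hint.norm.mul_const B).mono' (hm ε) (hbound ε hε), ?_⟩
  have hconst : CN N (s * p) * lamConst s p β *
      ∫ x in Ω, hardyIntegrand s p Ω (distPow Ω β) φ x =
      2 * ∫ x in Ω, hardyIntegrand s p Ω (distPow Ω β) φ x *
        (CN N (s * p) * lamConst s p β / 2) := by
    rw [integral_mul_const]; ring
  rw [hconst]
  refine Tendsto.const_mul _ (tendsto_integral_filter_of_dominated_convergence
    (fun x => ‖hardyIntegrand s p Ω (distPow Ω β) φ x‖ * B) (Eventually.of_forall hm) ?_
    (hint.norm.mul_const B) ?_)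
  · filter_upwards [self_mem_nhdsWithin] with ε hε
    exact hbound ε hε
  · refine (ae_restrict_iff' hΩo.measurableSet).2 (ae_of_all _ fun x hx => ?_)
    have hd := bdist_pos hΩo hΩ hx
    refine Tendsto.const_mul _ ((tendsto_halfPV hp hs0 hs1 hβ hβ' hν).comp
      (tendsto_nhdsWithin_iff.2 ⟨?_, ?_⟩))
    · have : Tendsto (fun ε : ℝ => ε / bdist Ω x) (𝓝 0) (𝓝 (0 / bdist Ω x)) :=
        tendsto_id.div_const _
      rw [zero_div] at this
      exact this.mono_left nhdsWithin_le_nhds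
    · filter_upwards [self_mem_nhdsWithin] with ε hε
      exact div_pos hε hd

lemma mul_truncPV_halfSpace (hp : 1 < p) (hsp : 0 < s * p)
    (hβ : -1 < β * (p - 1)) (hβ' : β * (p - 1) < s * p) (hΩo : IsOpen Ω) (hΩ : Ω ≠ univ)
    {ν ν' : Eu N} (hν : ‖ν‖ = 1) (hν' : ‖ν'‖ = 1) {c : ℝ} {x : Eu N} (hx : x ∈ Ω)
    (hd : bdist Ω x = inner ℝ ν' x - c) {ε : ℝ} (hε : 0 < ε) :
    φ x * truncPV p ((N : ℝ) + s * p) ε (fun y => posPow β (inner ℝ ν' y - c)) x =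
      halfSpaceTest s p β Ω φ ν ε x := by
  have hd0 := bdist_pos hΩo hΩ hx
  rw [truncPV_halfSpace (by linarith), halfSpaceTest, hardyIntegrand_distPow hp hΩo hΩ hx, hd,
    halfPV_congr hp hsp hβ hβ' hν hν' (div_pos hε (hd ▸ hd0))]
  ring

lemma setIntegral_mul_truncPV (hφ : IsTest s p Ω φ) (r ε : ℝ) (u : Eu N → ℝ) :
    ∫ x in Ω, φ x * truncPV p r ε u x = ∫ x, φ x * truncPV p r ε u x :=
  setIntegral_eq_integral_of_forall_compl_eq_zero fun x hx => by
    rw [hφ.eq_zero_of_notMem hx, zero_mul]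

/-- If at each point of `Ω` the distance power touches from below a half-space profile, it is a
local weak supersolution. -/
lemma isLocalWeakSupersolution_of_le (hN : 1 ≤ N) (hp : 1 < p) (hs0 : 0 < s) (hs1 : s < 1)
    (hβ : -1 < β * (p - 1)) (hβ' : β * (p - 1) < s * p) (hΩo : IsOpen Ω) (hΩ : Ω ≠ univ)
    (hne : Ω.Nonempty)
    (hsupp : ∀ x ∈ Ω, ∃ (ν : Eu N) (c : ℝ), ‖ν‖ = 1 ∧ bdist Ω x = inner ℝ ν x - c ∧
      ∀ y, distPow Ω β y ≤ posPow β (inner ℝ ν y - c)) :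
    IsLocalWeakSupersolution s p Ω (CN N (s * p) * lamConst s p β) (distPow Ω β) := by
  have hsp : 0 < s * p := by positivity
  obtain ⟨x₀, hx₀⟩ := hne
  obtain ⟨ν, c₀, hν, -, hle₀⟩ := hsupp x₀ hx₀
  have hu := measurable_distPow hΩo β
  have hW := memWloc_distPow hN hp hs1 hΩo hΩ β (s := s)
  have htail := integrable_distPow_tail hp hsp hβ hβ' hΩo hν hle₀
  have hb := locBdd_distPow hΩo hΩ β
  refine ⟨hW, memTail_of_integrable (by linarith) (by positivity) hu htail, fun φ hφ =>
    ⟨integrable_energyIntegrand hp hs0 hΩo hu hW htail hb hφ,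
      integrableOn_hardy hp hΩo hΩ hφ β, ?_⟩⟩
  obtain ⟨hci, hclim⟩ := tendsto_integral_compare hp hs0 hs1 hβ hβ' hΩo hΩ hφ hν
  refine le_of_tendsto_of_tendsto hclim
    (tendsto_truncated_energy hp hs0 hΩo hu hW htail hb hφ) ?_
  filter_upwards [self_mem_nhdsWithin] with ε hε
  have hε : 0 < ε := hε
  refine mul_le_mul_of_nonneg_left ?_ zero_le_two
  rw [← setIntegral_mul_truncPV hφ]
  refine setIntegral_mono_on (hci ε hε)
    (integral_far_energy hp hs0 hu htail hb hφ hε).1.integrableOn hΩo.measurableSet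
    fun x hx => ?_
  obtain ⟨ν', c, hν', hd, hle⟩ := hsupp x hx
  rw [← mul_truncPV_halfSpace hp hsp hβ hβ' hΩo hΩ hν hν' hx hd hε]
  refine mul_le_mul_of_nonneg_left ?_ (hφ.2.1 x)
  have hr : (N : ℝ) < (N : ℝ) + s * p := by linarith
  -- Equality at the touching point reduces the comparison to `u y` against the profile at y, where
  -- `Jp_mono` applies.
  have hux : distPow Ω β x = posPow β (inner ℝ ν' x - c) := by
    rw [← hd, posPow_of_pos (bdist_pos hΩo hΩ hx), distPow_of_mem hx]
  have hprofile : Integrable fun y : Eu N =>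
      |posPow β (inner ℝ ν' y - c)| ^ (p - 1) / (1 + ‖y‖) ^ ((N : ℝ) + s * p) := by
    have hH : IsOpen {y : Eu N | c < inner ℝ ν' y} := isOpen_lt (by fun_prop) (by fun_prop)
    have := integrable_distPow_tail hp hsp hβ hβ' hH hν' (c := c)
      fun y => (distPow_halfSpace hν' c β y).le
    simpa only [distPow_halfSpace hν' c β] using this
  rw [truncPV, truncPV, hux]
  refine setIntegral_mono_on (integrableOn_far hp hr (by fun_prop) hprofile x _ hε)
    (integrableOn_far hp hr hu htail x _ hε) (measurableSet_far x ε) fun y _ => ?_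
  refine div_le_div_of_nonneg_right ?_ (by positivity)
  exact Jp_mono hp (by linarith [hle y])

/-- The distance power is its own comparison profile, so the truncated integrals agree for each ε >
0 and uniqueness of limits gives equality. -/
lemma isLocalWeakSolution_halfSpace (hN : 1 ≤ N) (hp : 1 < p) (hs0 : 0 < s) (hs1 : s < 1)
    (hβ : -1 < β * (p - 1)) (hβ' : β * (p - 1) < s * p) {ν : Eu N} (hν : ‖ν‖ = 1) (c : ℝ)
    (hΩ : {x : Eu N | c < inner ℝ ν x} ≠ univ) :
    IsLocalWeakSolution s p {x : Eu N | c < inner ℝ ν x} (CN N (s * p) * lamConst s p β)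
      (distPow {x : Eu N | c < inner ℝ ν x} β) := by
  set H := {x : Eu N | c < inner ℝ ν x} with hH
  have hsp : 0 < s * p := by positivity
  have hHo : IsOpen H := isOpen_lt (by fun_prop) (by fun_prop)
  have hne : H.Nonempty := by
    refine ⟨(c + 1) • ν, ?_⟩
    rw [hH, mem_ofPred_eq, inner_smul_right, real_inner_self_eq_norm_sq, hν]
    linarith
  have hprof : distPow H β = fun y => posPow β (inner ℝ ν y - c) :=
    funext fun y => distPow_halfSpace hν c β y
  have hsuper := isLocalWeakSupersolution_of_le hN hp hs0 hs1 hβ hβ' hHo hΩ hne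
    fun x hx => ⟨ν, c, hν, bdist_halfSpace hν hx, fun y => (distPow_halfSpace hν c β y).le⟩
  refine ⟨hsuper, hsuper.1, hsuper.2.1, fun φ hφ =>
    ⟨(hsuper.2.2 φ hφ).1, (hsuper.2.2 φ hφ).2.1, ?_⟩⟩
  refine le_of_eq (tendsto_nhds_unique (tendsto_truncated_energy hp hs0 hHo
    (measurable_distPow hHo β) hsuper.1 hsuper.2.1.2 (locBdd_distPow hHo hΩ β) hφ)
    ((tendsto_integral_compare hp hs0 hs1 hβ hβ' hHo hΩ hφ hν).2.congr' ?_))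
  filter_upwards [self_mem_nhdsWithin] with ε hε
  rw [← setIntegral_mul_truncPV hφ, hprof]
  congr 1
  exact setIntegral_congr_fun hHo.measurableSet fun x hx =>
    (mul_truncPV_halfSpace hp hsp hβ hβ' hHo hΩ hν hν hx (bdist_halfSpace hν hx) hε).symm

/-- The empty set is open and convex but has no point at which to take a supporting half-space; the
function is then identically zero. -/
lemma isLocalWeakSupersolution_empty (hp : 1 < p) (lam : ℝ) :
    IsLocalWeakSupersolution s p (∅ : Set (Eu N)) lam (distPow ∅ β) := by
  have h0 : distPow (∅ : Set (Eu N)) β = fun _ => 0 := funext fun x => by simp [distPow]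
  have hp0 : p ≠ 0 := by linarith
  have hp1 : p - 1 ≠ 0 := by linarith
  rw [h0]
  refine ⟨fun E _ _ _ => ⟨MemLp.zero', by simp [gagliardo, Real.zero_rpow hp0]⟩,
    ⟨fun K _ => MemLp.zero', by simp [Real.zero_rpow hp1]⟩, fun φ _ => ?_⟩
  have he : energyIntegrand s p (fun _ : Eu N => 0) φ = fun _ => 0 :=
    funext fun z => by simp [energyIntegrand, Jp]
  refine ⟨?_, integrableOn_empty, ?_⟩ <;> simp [he]

end

end FracHardy

end

theorem mainTheorem2 (N : ℕ) (hN : 1 ≤ N) (p s : ℝ) (hp : 1 < p) (hs0 : 0 < s) (hs1 : s < 1)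
    (Ω : Set (FracHardy.Eu N)) (hΩo : IsOpen Ω) (hΩc : Convex ℝ Ω) (hΩ : Ω ≠ Set.univ) :
    (∀ β : ℝ, 0 ≤ β → β < s * p / (p - 1) →
      FracHardy.IsLocalWeakSupersolution s p Ω
        (FracHardy.CN N (s * p) * FracHardy.lamConst s p β) (FracHardy.distPow Ω β)) ∧
    (FracHardy.IsHalfSpace Ω →
      ∀ β : ℝ, -1 / (p - 1) < β → β < s * p / (p - 1) →
        FracHardy.IsLocalWeakSolution s p Ω
          (FracHardy.CN N (s * p) * FracHardy.lamConst s p β) (FracHardy.distPow Ω β)) := by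
  have hp1 : 0 < p - 1 := by linarith
  refine ⟨fun β hβ0 hβ => ?_, fun hH β hβ hβ' => ?_⟩
  · rcases Ω.eq_empty_or_nonempty with rfl | hne
    · exact FracHardy.isLocalWeakSupersolution_empty hp _
    refine FracHardy.isLocalWeakSupersolution_of_le hN hp hs0 hs1 ?_ ((lt_div_iff₀ hp1).1 hβ)
      hΩo hΩ hne fun x hx => ?_
    · linarith [mul_nonneg hβ0 hp1.le]
    · obtain ⟨ν, c, hν, hsub, hd⟩ := FracHardy.exists_supporting_halfSpace hΩo hΩc hΩ hx
      exact ⟨ν, c, hν, hd, FracHardy.distPow_le_posPow hΩo hΩ hν hsub hβ0⟩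
  · obtain ⟨ν, c, hν, rfl⟩ := hH.exists_unit
    exact FracHardy.isLocalWeakSolution_halfSpace hN hp hs0 hs1 ((div_lt_iff₀ hp1).1 hβ)
      ((lt_div_iff₀ hp1).1 hβ') hν c hΩ
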